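/- **Counting and Inverse Counting Lemma I.** Let $\mathcal H$ be a real separable Hilbert space and let $\mathcal B$ be a real Banach space compactly embedded into $\mathcal H$ (i.e. $\mathcal B\subset\mathcal H$ through an injective compact linear map). Let $L^\infty([0,1]^2;\mathcal B)$ denote the space of kernels $\bm w:[0,1]^2\to\mathcal B$ that are Lebesgue measurable as maps into $\mathcal H$ and satisfy $\|\bm w\|_{L^\infty([0,1]^2;\mathcal B)}:=\operatorname{ess\,sup}\|\bm w(\xi,\zeta)\|_{\mathcal B}<\infty$. Let $\bm w_n$ ($n\in\mathbb N$) and $\bm w$ belong to $L^\infty([0,1]^2;\mathcal B)$, with $$\sup_n \|\bm w_n\|_{L^\infty([0,1]^2;\mathcal B)} < w_{\max} < \infty .$$ An oriented simple graph $F$ is a finite vertex set $\mathsf v(F)$ with a set of directed edges $\mathsf e(F)\subset \mathsf v(F)\times\mathsf v(F)$ such that $(i,j)\in\mathsf e(F)$ implies $(j,i)\notin\mathsf e(F)$ (so there are no loops). Its tensorized homomorphism density in $\bm w$ is $$\bm t(F,\bm w) := \int_{[0,1]^{\mathsf v(F)}} \bigotimes_{(i,j)\in\mathsf e(F)} \bm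 w(\xi_i,\xi_j)\prod_{i\in\mathsf v(F)}\mathrm d\xi_i \ \in\ \mathcal H^{\otimes \mathsf e(F)},$$ where $\mathcal H^{\otimes \mathsf e(F)}$ is the Hilbert tensor product of copies of $\mathcal H$ indexed by $\mathsf e(F)$. For $\bm u\in L^\infty([0,1]^2;\mathcal H)$ let $$\|\bm u\|_{\square;\mathcal H} := \sup_{\|\bm e\|_{\mathcal H}\le 1,\ S,T\subset[0,1]\text{ measurable}} \Big\langle \bm e, \int_{S\times T}\bm u(\xi,\zeta)\,\mathrm d\xi\,\mathrm d\zeta\Big\rangle_{\mathcal H},$$ and let $$\delta_{\square;\mathcal H}(\bm u_1,\bm u_2) := \inf_\Phi \|\bm u_1-\bm u_2(\Phi(\cdot),\Phi(\cdot))\|_{\square;\mathcal H},$$ where $\Phi$ ranges over all bijective measure-preserving maps $\Phi:[0,1]\to[0,1]$. Then the following two notions of convergence are equivalent: 1. for every oriented simple graph $F$, $\displaystyle\lim_{n\to\infty}\|\bm t(F,\bm w_n)-\bm t(F,\bm w)\|_{\mathcal H^{\otimes\mathsf e(F)}}=0$; 2. $\displaystyle\lim_{n\to\infty}\delta_{\square;\mathcal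 H}(\bm w_n,\bm w)=0$. -/

import Mathlib

open MeasureTheory Filter Topology
open scoped TensorProduct ENNReal NNReal

noncomputable section

/-! ### Hilbert tensor powers -/

/-- The algebraic tensor power of `H` over the finite index set `S`, carrying (below) the Hilbert
inner product, `⟪⨂ vᵢ, ⨂ uᵢ⟫ = ∏ ⟪vᵢ, uᵢ⟫` on elementary tensors. -/
def AlgTensorPower (S H : Type*) [NormedAddCommGroup H] [InnerProductSpace ℝ H] : Type _ :=
  ⨂[ℝ] _ : S, H

namespace AlgTensorPower

variable (S H : Type*) [NormedAddCommGroup H] [InnerProductSpace ℝ H]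

instance : AddCommGroup (AlgTensorPower S H) := inferInstanceAs (AddCommGroup (⨂[ℝ] _ : S, H))

instance : Module ℝ (AlgTensorPower S H) := inferInstanceAs (Module ℝ (⨂[ℝ] _ : S, H))

/-- The elementary tensor `⨂ vᵢ`. -/
def tprod : MultilinearMap ℝ (fun _ : S => H) (AlgTensorPower S H) :=
  PiTensorProduct.tprod ℝ


/-- The bilinear form determined by `⟪⨂ vᵢ, ⨂ uᵢ⟫ = ∏ ⟪vᵢ, uᵢ⟫`. -/
def form [Fintype S] : AlgTensorPower S H →ₗ[ℝ] AlgTensorPower S H →ₗ[ℝ] ℝ :=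
  (PiTensorProduct.dualDistrib (R := ℝ) (M := fun _ : S => H)) ∘ₗ
    (PiTensorProduct.map fun _ : S => innerₗ H)

theorem form_tprod [Fintype S] (v u : S → H) :
    form S H (tprod S H v) (tprod S H u) = ∏ i, inner ℝ (v i) (u i) := by
  change PiTensorProduct.dualDistrib (PiTensorProduct.map (fun _ : S => innerₗ H)
    (PiTensorProduct.tprod ℝ v)) (PiTensorProduct.tprod ℝ u) = _
  rw [PiTensorProduct.map_tprod, PiTensorProduct.dualDistrib_apply]
  simp

theorem exists_sum_tprod (x : AlgTensorPower S H) :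
    ∃ (n : ℕ) (c : Fin n → ℝ) (v : Fin n → S → H), x = ∑ k, c k • tprod S H (v k) := by
  refine PiTensorProduct.induction_on x ?_ ?_
  · intro r f
    exact ⟨1, fun _ => r, fun _ => f, by rw [Fin.sum_univ_one]; rfl⟩
  · rintro x y ⟨n, c, v, rfl⟩ ⟨m, d, u, rfl⟩
    refine ⟨n + m, Fin.append c d, Fin.append v u, ?_⟩
    rw [Fin.sum_univ_add]
    simp only [Fin.append_left, Fin.append_right]
    rfl

theorem form_symm [Fintype S] (x y : AlgTensorPower S H) : form S H x y = form S H y x := by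
  obtain ⟨n, c, v, rfl⟩ := exists_sum_tprod S H x
  obtain ⟨m, d, u, rfl⟩ := exists_sum_tprod S H y
  simp only [map_sum, map_smul, LinearMap.sum_apply, LinearMap.smul_apply, form_tprod,
    Finset.mul_sum, smul_eq_mul]
  rw [Finset.sum_comm]
  refine Finset.sum_congr rfl fun i _ => Finset.sum_congr rfl fun j _ => ?_
  simp only [real_inner_comm]
  ring

theorem posSemidef_prod_inner {n : ℕ} (v : Fin n → S → H) (T : Finset S) :
    (Matrix.of fun k l => ∏ i ∈ T, inner ℝ (v k i) (v l i) :
      Matrix (Fin n) (Fin n) ℝ).PosSemidef := by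
  classical
  induction T using Finset.induction_on with
  | empty =>
    have h := Matrix.posSemidef_gram ℝ (fun _ : Fin n => (1 : ℝ))
    have e : (Matrix.of fun k l => ∏ i ∈ (∅ : Finset S), inner ℝ (v k i) (v l i)) =
        Matrix.gram ℝ (fun _ : Fin n => (1 : ℝ)) := by
      ext k l
      simp [Matrix.gram]
    rw [e]
    exact h
  | insert a T ha ih =>
    have h := (Matrix.posSemidef_gram ℝ (fun k => v k a)).hadamard ih
    have e : (Matrix.of fun k l => ∏ i ∈ insert a T, inner ℝ (v k i) (v l i)) =
        (Matrix.gram ℝ (fun k => v k a)).hadamard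
          (Matrix.of fun k l => ∏ i ∈ T, inner ℝ (v k i) (v l i)) := by
      ext k l
      simp [Matrix.gram, Finset.prod_insert ha]
    rw [e]
    exact h

theorem form_self_nonneg [Fintype S] (x : AlgTensorPower S H) : 0 ≤ form S H x x := by
  obtain ⟨n, c, v, rfl⟩ := exists_sum_tprod S H x
  have h := (posSemidef_prod_inner S H v Finset.univ).dotProduct_mulVec_nonneg c
  have e : form S H (∑ k, c k • tprod S H (v k)) (∑ k, c k • tprod S H (v k)) =
      star c ⬝ᵥ (Matrix.of fun k l => ∏ i, inner ℝ (v k i) (v l i)).mulVec c := by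
    simp only [map_sum, map_smul, LinearMap.sum_apply, LinearMap.smul_apply, form_tprod,
      smul_eq_mul, dotProduct, Matrix.mulVec, Matrix.of_apply, Pi.star_apply, star_trivial]
    refine Finset.sum_congr rfl fun i _ => ?_
    congr 1
    refine Finset.sum_congr rfl fun j _ => ?_
    rw [mul_comm]
    congr 1
    exact Finset.prod_congr rfl fun s _ => real_inner_comm _ _
  rw [e]
  exact h

/-- The inner product of the tensor power. -/
@[reducible] def core [Fintype S] : PreInnerProductSpace.Core ℝ (AlgTensorPower S H) where
  inner x y := form S H x y
  conj_inner_symm x y := by simpa using form_symm S H y x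
  re_inner_nonneg x := by simpa using form_self_nonneg S H x
  add_left x y z := by simp
  smul_left x y r := by simp

instance [Fintype S] : SeminormedAddCommGroup (AlgTensorPower S H) :=
  InnerProductSpace.Core.toSeminormedAddCommGroup (c := core S H)

instance [Fintype S] : InnerProductSpace ℝ (AlgTensorPower S H) :=
  InnerProductSpace.ofCore (core S H)

theorem inner_def [Fintype S] (x y : AlgTensorPower S H) : inner ℝ x y = form S H x y := rfl

end AlgTensorPower

/-- The Hilbert tensor power `H^{⊗ S}`: the completion of the algebraic tensor power with respect
to its Hilbert inner product. -/
abbrev HilbertTensorPower (S H : Type*) [Fintype S] [NormedAddCommGroup H]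
    [InnerProductSpace ℝ H] : Type _ :=
  UniformSpace.Completion (AlgTensorPower S H)

/-- The elementary tensor `⨂ vᵢ` in the Hilbert tensor power. -/
def hilbertTprod {S H : Type*} [Fintype S] [NormedAddCommGroup H] [InnerProductSpace ℝ H]
    (v : S → H) : HilbertTensorPower S H :=
  ((AlgTensorPower.tprod S H v : AlgTensorPower S H) : UniformSpace.Completion (AlgTensorPower S H))

theorem inner_hilbertTprod {S H : Type*} [Fintype S] [NormedAddCommGroup H]
    [InnerProductSpace ℝ H] (v u : S → H) :
    inner ℝ (hilbertTprod v) (hilbertTprod u) = ∏ i, inner ℝ (v i) (u i) := by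
  rw [hilbertTprod, hilbertTprod, UniformSpace.Completion.inner_coe, AlgTensorPower.inner_def,
    AlgTensorPower.form_tprod]

/-! ### Oriented simple graphs and homomorphism densities -/

/-- An oriented simple graph with vertex set `V`: a set of directed edges such that an edge and its
reversal never both occur. In particular there are no loops. -/
structure OrientedSimpleGraph (V : Type*) where
  edges : Finset (V × V)
  oriented : ∀ i j : V, (i, j) ∈ edges → (j, i) ∉ edges

/-- The tensorized homomorphism density
`t(F, u) = ∫_{[0,1]^V} ⨂_{(i,j) ∈ e(F)} u(ξᵢ, ξⱼ) ∏ dξᵢ ∈ H^{⊗ e(F)}` (a Bochner integral). -/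
def homDensity {V H : Type*} [Fintype V] [NormedAddCommGroup H] [InnerProductSpace ℝ H]
    (F : OrientedSimpleGraph V) (u : unitInterval × unitInterval → H) :
    HilbertTensorPower F.edges H :=
  ∫ ξ : V → unitInterval, hilbertTprod fun e : F.edges => u (ξ e.1.1, ξ e.1.2)

/-! ### Cut norm and unlabeled cut distance -/

section Cut

variable {H : Type*} [NormedAddCommGroup H] [InnerProductSpace ℝ H]

/-- The cut norm `sup ⟪e, ∫_{S × T} u⟫` over `‖e‖ ≤ 1` and measurable `S, T ⊆ [0,1]`. -/
def cutNorm (u : unitInterval × unitInterval → H) : ℝ :=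
  sSup {r : ℝ | ∃ (e : H) (S T : Set unitInterval), ‖e‖ ≤ 1 ∧ MeasurableSet S ∧ MeasurableSet T ∧
    r = inner ℝ e (∫ z in S ×ˢ T, u z)}

/-- The unlabeled cut distance `inf_Φ ‖u₁ - u₂ ∘ (Φ × Φ)‖_□` over all bijective measure-preserving
maps `Φ` of `[0,1]`. -/
def cutDist (u₁ u₂ : unitInterval × unitInterval → H) : ℝ :=
  ⨅ Φ : {Φ : unitInterval → unitInterval //
      Function.Bijective Φ ∧ MeasurePreserving Φ volume volume},
    cutNorm fun z => u₁ z - u₂ (Φ.1 z.1, Φ.1 z.2)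

end Cut

/-! ### Kernels -/

/-- `w ∈ L^∞([0,1]²; B)`, where `ι : B → H` is the embedding: `w` is measurable as a map into `H`
and has essentially bounded `B`-norm. No strong measurability into `B` is required, so that
measure-valued kernels such as `(ξ, ζ) ↦ δ_{X(ζ)}` are included; every strongly measurable
essentially bounded `w` qualifies. -/
def IsLinftyKernel {B H : Type*} [NormedAddCommGroup B] [NormedSpace ℝ B] [NormedAddCommGroup H]
    [InnerProductSpace ℝ H] (ι : B →L[ℝ] H) (w : unitInterval × unitInterval → B) : Prop :=
  AEStronglyMeasurable (fun z => ι (w z)) volume ∧ eLpNorm w ∞ volume < ∞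

end

/-!
Almost all values of the kernels lie in one compact subset of `H`, on which the projection to a
suitable finite-dimensional subspace is uniformly close to the identity. Both the cut norm and the
tensorized densities are therefore controlled by finitely many scalar coordinate kernels, the
coordinates of the tensorized density being the densities of `F` with a scalar kernel chosen for
each edge. Scalar kernels are approximated in `L¹` by step kernels, that is by matrices on an
equipartition of the interval, and every permutation of the cells is a measure-preserving
bijection.

For matrices, densities are Lipschitz in the cut norm by exchanging one edge at a time. Conversely,
draw `k` points from the index set of the matrices and observe each unordered pair of points once:
choose a direction and a colour (a coordinate kernel) uniformly and return a random sign whose mean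
is proportional to the observed entry. The law of the resulting configuration is a linear
combination of densities of oriented graphs on `k` vertices; looking at each pair in only one
direction is what makes oriented simple graphs suffice. Close densities thus give close laws, hence
a common configuration that is typical for both families of matrices. A typical configuration
represents its family: by weak regularity the family is close to step matrices over a partition, the
estimated matrices are close in four-cycle norm to those step matrices along the sample, and the
sample meets every class in about the right proportion. So each family is close in cut norm, after a
permutation, to the blow-up of one and the same estimated family.
-/

open scoped BigOperators

noncomputable section

universe u

section FiniteCut

variable {X : Type*} [Fintype X]

theorem abs_expect_le_of_forall_abs_le {α : Type*} {S : Finset α} {f : α → ℝ} {a : ℝ}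
    (ha : 0 ≤ a) (hf : ∀ x ∈ S, |f x| ≤ a) : |𝔼 x ∈ S, f x| ≤ a := by
  rcases S.eq_empty_or_nonempty with rfl | hS
  · simpa using ha
  · exact (Finset.abs_expect_le _ _).trans (Finset.expect_le hS hf)

theorem expect_expect_eq_sum_div (D : X → X → ℝ) :
    𝔼 x, 𝔼 y, D x y = (∑ x, ∑ y, D x y) / (Fintype.card X : ℝ) ^ 2 := by
  simp only [Fintype.expect_eq_sum_div_card, ← Finset.sum_div]
  rw [div_div, sq]

/-- The normalized cut norm of the matrix `D` is at most `ε`. -/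
def CutLE (D : X → X → ℝ) (ε : ℝ) : Prop :=
  ∀ S T : Finset X, |∑ x ∈ S, ∑ y ∈ T, D x y| ≤ ε * (Fintype.card X : ℝ) ^ 2

namespace CutLE

variable {D D' : X → X → ℝ} {ε δ : ℝ}

theorem mono (h : CutLE D ε) (hεδ : ε ≤ δ) : CutLE D δ :=
  fun S T => (h S T).trans (by gcongr)

theorem add (h : CutLE D ε) (h' : CutLE D' δ) : CutLE (fun x y => D x y + D' x y) (ε + δ) := by
  intro S T
  simp only [Finset.sum_add_distrib, add_mul]
  exact (abs_add_le _ _).trans (add_le_add (h S T) (h' S T))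

theorem neg (h : CutLE D ε) : CutLE (fun x y => -D x y) ε := by
  intro S T
  simpa only [Finset.sum_neg_distrib, abs_neg] using h S T

theorem sub (h : CutLE D ε) (h' : CutLE D' δ) : CutLE (fun x y => D x y - D' x y) (ε + δ) := by
  simpa only [sub_eq_add_neg] using h.add h'.neg

theorem comp_perm (h : CutLE D ε) (σ : Equiv.Perm X) : CutLE (fun x y => D (σ x) (σ y)) ε := by
  intro S T
  simpa only [Finset.sum_map, Equiv.coe_toEmbedding] using
    h (S.map σ.toEmbedding) (T.map σ.toEmbedding)

theorem of_sum_abs (h : ∑ x, ∑ y, |D x y| ≤ ε * (Fintype.card X : ℝ) ^ 2) : CutLE D ε := by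
  intro S T
  refine le_trans ?_ h
  calc |∑ x ∈ S, ∑ y ∈ T, D x y| ≤ ∑ x ∈ S, ∑ y ∈ T, |D x y| :=
        (Finset.abs_sum_le_sum_abs _ _).trans
          (Finset.sum_le_sum fun _ _ => Finset.abs_sum_le_sum_abs _ _)
    _ ≤ ∑ x ∈ S, ∑ y, |D x y| := Finset.sum_le_sum fun _ _ =>
        Finset.sum_le_univ_sum_of_nonneg fun _ => abs_nonneg _
    _ ≤ ∑ x, ∑ y, |D x y| :=
        Finset.sum_le_univ_sum_of_nonneg fun _ => Finset.sum_nonneg fun _ _ => abs_nonneg _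

end CutLE

theorem exists_abs_sum_mul_le {f : X → ℝ} {a : ℝ} (ha : 0 ≤ a) (hf : ∀ x, |f x| ≤ a)
    (c : X → ℝ) : ∃ S : Finset X, |∑ x, f x * c x| ≤ 2 * a * |∑ x ∈ S, c x| := by
  classical
  have hpos : ∑ x with 0 ≤ c x, |c x| = |∑ x with 0 ≤ c x, c x| := by
    have hc : ∀ x ∈ ({x | 0 ≤ c x} : Finset X), 0 ≤ c x := fun x hx => (Finset.mem_filter.1 hx).2
    rw [abs_of_nonneg (Finset.sum_nonneg hc)]
    exact Finset.sum_congr rfl fun x hx => abs_of_nonneg (hc x hx)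
  have hneg : ∑ x with ¬0 ≤ c x, |c x| = |∑ x with ¬0 ≤ c x, c x| := by
    have hc : ∀ x ∈ ({x | ¬0 ≤ c x} : Finset X), c x ≤ 0 :=
      fun x hx => (not_le.1 (Finset.mem_filter.1 hx).2).le
    rw [abs_of_nonpos (Finset.sum_nonpos hc), ← Finset.sum_neg_distrib]
    exact Finset.sum_congr rfl fun x hx => abs_of_nonpos (hc x hx)
  have hsum : |∑ x, f x * c x| ≤
      a * (|∑ x with 0 ≤ c x, c x| + |∑ x with ¬0 ≤ c x, c x|) := by
    rw [← hpos, ← hneg, Finset.sum_filter_add_sum_filter_not, Finset.mul_sum]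
    refine (Finset.abs_sum_le_sum_abs _ _).trans (Finset.sum_le_sum fun x _ => ?_)
    rw [abs_mul]
    gcongr
    exact hf x
  rcases le_total |∑ x with 0 ≤ c x, c x| |∑ x with ¬0 ≤ c x, c x| with h | h
  · exact ⟨({x | ¬0 ≤ c x} : Finset X), by nlinarith⟩
  · exact ⟨({x | 0 ≤ c x} : Finset X), by nlinarith⟩

theorem CutLE.abs_sum_mul_mul_le {D : X → X → ℝ} {ε a b : ℝ} (h : CutLE D ε) {f g : X → ℝ}
    (ha : 0 ≤ a) (hb : 0 ≤ b) (hf : ∀ x, |f x| ≤ a) (hg : ∀ x, |g x| ≤ b) :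
    |∑ x, ∑ y, f x * g y * D x y| ≤ 4 * a * b * ε * (Fintype.card X : ℝ) ^ 2 := by
  obtain ⟨S, hS⟩ := exists_abs_sum_mul_le ha hf fun x => ∑ y, g y * D x y
  obtain ⟨T, hT⟩ := exists_abs_sum_mul_le hb hg fun y => ∑ x ∈ S, D x y
  calc |∑ x, ∑ y, f x * g y * D x y| = |∑ x, f x * ∑ y, g y * D x y| := by
        simp only [Finset.mul_sum, mul_assoc]
    _ ≤ 2 * a * |∑ x ∈ S, ∑ y, g y * D x y| := hS
    _ = 2 * a * |∑ y, g y * ∑ x ∈ S, D x y| := by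
        rw [Finset.sum_comm]; simp only [Finset.mul_sum]
    _ ≤ 2 * a * (2 * b * |∑ y ∈ T, ∑ x ∈ S, D x y|) := by gcongr
    _ ≤ 2 * a * (2 * b * (ε * (Fintype.card X : ℝ) ^ 2)) := by
        rw [Finset.sum_comm]; gcongr; exact h S T
    _ = _ := by ring

theorem CutLE.abs_expect_mul_mul_le {D : X → X → ℝ} {ε a b : ℝ} (h : CutLE D ε) {f g : X → ℝ}
    (ha : 0 ≤ a) (hb : 0 ≤ b) (hf : ∀ x, |f x| ≤ a) (hg : ∀ x, |g x| ≤ b) (hε : 0 ≤ ε) :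
    |𝔼 x, 𝔼 y, f x * g y * D x y| ≤ 4 * a * b * ε := by
  rw [expect_expect_eq_sum_div fun x y => f x * g y * D x y, abs_div,
    abs_of_nonneg (by positivity : (0 : ℝ) ≤ (Fintype.card X : ℝ) ^ 2)]
  exact div_le_of_le_mul₀ (by positivity) (by positivity) (h.abs_sum_mul_mul_le ha hb hf hg)

/-- The density of the oriented four-cycle `K_{2,2}` in the matrix `D`; its fourth root is
equivalent to the cut norm on bounded matrices. -/
def fourCycle (D : X → X → ℝ) : ℝ :=
  𝔼 x, 𝔼 x', 𝔼 y, 𝔼 y', D x y * D x y' * D x' y * D x' y'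

theorem fourCycle_eq_expect_sq (D : X → X → ℝ) :
    fourCycle D = 𝔼 y, 𝔼 y', (𝔼 x, D x y * D x y') ^ 2 := by
  have hcomm := Finset.expect_comm Finset.univ Finset.univ fun p q : X × X =>
    D p.1 q.1 * D p.1 q.2 * D p.2 q.1 * D p.2 q.2
  simpa only [fourCycle, sq, Finset.expect_mul_expect, ← Finset.univ_product_univ,
    Finset.expect_product, mul_assoc] using hcomm

theorem fourCycle_nonneg (D : X → X → ℝ) : 0 ≤ fourCycle D := by
  rw [fourCycle_eq_expect_sq]
  exact Finset.expect_nonneg fun _ _ => Finset.expect_nonneg fun _ _ => sq_nonneg _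

theorem sq_sum_le_card_mul_sum_univ_sq (S : Finset X) (f : X → ℝ) :
    (∑ x ∈ S, f x) ^ 2 ≤ Fintype.card X * ∑ x, f x ^ 2 :=
  sq_sum_le_card_mul_sum_sq.trans <| mul_le_mul (by exact_mod_cast Finset.card_le_univ S)
    (Finset.sum_le_univ_sum_of_nonneg fun _ => sq_nonneg _)
    (Finset.sum_nonneg fun _ _ => sq_nonneg _) (Nat.cast_nonneg _)

theorem pow_four_sum_le_fourCycle (D : X → X → ℝ) (S T : Finset X) :
    (∑ x ∈ S, ∑ y ∈ T, D x y) ^ 4 ≤ (Fintype.card X : ℝ) ^ 8 * fourCycle D := by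
  set N : ℝ := (Fintype.card X : ℝ) with hN
  have hpairs : ∑ x, (∑ y ∈ T, D x y) ^ 2 = ∑ p ∈ T ×ˢ T, ∑ x, D x p.1 * D x p.2 := by
    rw [Finset.sum_comm]
    exact Finset.sum_congr rfl fun x _ => by rw [sq, Finset.sum_mul_sum, Finset.sum_product]
  have hcycle : ∑ p : X × X, (∑ x, D x p.1 * D x p.2) ^ 2 = N ^ 4 * fourCycle D := by
    rw [Fintype.sum_prod_type, fourCycle_eq_expect_sq]
    simp only [← Fintype.card_mul_expect, mul_pow, ← Finset.mul_expect, ← hN]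
    ring
  calc (∑ x ∈ S, ∑ y ∈ T, D x y) ^ 4 = ((∑ x ∈ S, ∑ y ∈ T, D x y) ^ 2) ^ 2 := by ring
    _ ≤ (N * ∑ x, (∑ y ∈ T, D x y) ^ 2) ^ 2 := by
        gcongr; exact sq_sum_le_card_mul_sum_univ_sq S _
    _ = N ^ 2 * (∑ p ∈ T ×ˢ T, ∑ x, D x p.1 * D x p.2) ^ 2 := by rw [hpairs, mul_pow]
    _ ≤ N ^ 2 * ((Fintype.card (X × X) : ℝ) * ∑ p : X × X, (∑ x, D x p.1 * D x p.2) ^ 2) := by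
        gcongr; exact sq_sum_le_card_mul_sum_univ_sq _ _
    _ = N ^ 8 * fourCycle D := by rw [hcycle, Fintype.card_prod]; push_cast; ring

theorem CutLE.of_fourCycle_le {D : X → X → ℝ} {ε : ℝ} (hε : 0 ≤ ε) (h : fourCycle D ≤ ε ^ 4) :
    CutLE D ε := by
  intro S T
  refine le_of_pow_le_pow_left₀ four_ne_zero (by positivity) ?_
  calc |∑ x ∈ S, ∑ y ∈ T, D x y| ^ 4 = (∑ x ∈ S, ∑ y ∈ T, D x y) ^ 4 :=
        Even.pow_abs (by decide) _
    _ ≤ (Fintype.card X : ℝ) ^ 8 * ε ^ 4 :=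
        (pow_four_sum_le_fourCycle D S T).trans (by gcongr)
    _ = _ := by ring

theorem CutLE.fourCycle_le {D : X → X → ℝ} {ε B : ℝ} (h : CutLE D ε) (hε : 0 ≤ ε) (hB : 0 ≤ B)
    (hD : ∀ x y, |D x y| ≤ B) : fourCycle D ≤ 4 * B ^ 3 * ε := by
  have hsplit : fourCycle D = 𝔼 x', 𝔼 y', D x' y' * 𝔼 x, 𝔼 y, D x y' * D x' y * D x y := by
    rw [fourCycle, Finset.expect_comm]
    refine Finset.expect_congr rfl fun x' _ => ?_
    simp only [Finset.mul_expect]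
    conv_rhs => rw [Finset.expect_comm]
    refine Finset.expect_congr rfl fun x _ => ?_
    rw [Finset.expect_comm]
    exact Finset.expect_congr rfl fun y' _ => Finset.expect_congr rfl fun y _ => by ring
  have hbound : ∀ x' y', |D x' y' * 𝔼 x, 𝔼 y, D x y' * D x' y * D x y| ≤
      B * (4 * B * B * ε) := fun x' y' => by
    rw [abs_mul]
    exact mul_le_mul (hD x' y') (h.abs_expect_mul_mul_le hB hB (fun x => hD x y')
      (fun y => hD x' y) hε) (abs_nonneg _) hB
  rw [hsplit]
  refine (le_abs_self _).trans ((abs_expect_le_of_forall_abs_le (by positivity) fun x' _ =>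
    abs_expect_le_of_forall_abs_le (by positivity) fun y' _ => hbound x' y').trans_eq (by ring))

theorem exists_sum_sq_sub_le_of_not_cutLE {D : X → X → ℝ} {ε : ℝ} (hε : 0 ≤ ε)
    (h : ¬CutLE D ε) : ∃ (S T : X → Bool) (c : ℝ),
      ∑ x, ∑ y, (D x y - if S x ∧ T y then c else 0) ^ 2 ≤
        ∑ x, ∑ y, D x y ^ 2 - ε ^ 2 * (Fintype.card X : ℝ) ^ 2 := by
  classical
  simp only [CutLE, not_forall, not_le] at h
  obtain ⟨S, T, hST⟩ := h
  set N : ℝ := (Fintype.card X : ℝ)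
  set s : ℝ := ∑ x ∈ S, ∑ y ∈ T, D x y with hs
  obtain ⟨c, hc, hcs⟩ : ∃ c : ℝ, c ^ 2 = ε ^ 2 ∧ c * s = ε * |s| := by
    rcases le_total 0 s with h | h
    · exact ⟨ε, rfl, by rw [abs_of_nonneg h]⟩
    · exact ⟨-ε, neg_sq ε, by rw [abs_of_nonpos h]; ring⟩
  have hcard : (S.card * T.card : ℝ) ≤ N ^ 2 := by
    have hle : ∀ U : Finset X, (U.card : ℝ) ≤ N := fun U => Nat.cast_le.2 (Finset.card_le_univ U)
    rw [sq]
    exact mul_le_mul (hle S) (hle T) (Nat.cast_nonneg _) (Nat.cast_nonneg _)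
  have hexpand : ∑ x, ∑ y, (D x y - if decide (x ∈ S) ∧ decide (y ∈ T) then c else 0) ^ 2 =
      ∑ x, ∑ y, D x y ^ 2 - 2 * (c * s) + c ^ 2 * (S.card * T.card) := by
    have hrect : ∀ f : X → X → ℝ, ∑ x ∈ S, ∑ y ∈ T, f x y =
        ∑ x, ∑ y, if x ∈ S ∧ y ∈ T then f x y else 0 := fun f => by
      simp only [ite_and, Finset.sum_ite_irrel, Finset.sum_ite_mem, Finset.univ_inter,
        Finset.sum_const_zero]
    have hone : (S.card * T.card : ℝ) = ∑ x ∈ S, ∑ y ∈ T, 1 := by simp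
    rw [hone, hs, hrect, hrect]
    simp only [Finset.mul_sum, ← Finset.sum_sub_distrib, ← Finset.sum_add_distrib]
    refine Finset.sum_congr rfl fun x _ => Finset.sum_congr rfl fun y _ => ?_
    by_cases hxy : x ∈ S ∧ y ∈ T
    · simp only [hxy, decide_true, and_self, if_true]; ring
    · simp only [decide_eq_true_eq, hxy, if_false]; ring
  refine ⟨fun x => decide (x ∈ S), fun y => decide (y ∈ T), c, ?_⟩
  rw [hexpand, hcs, hc]
  nlinarith [mul_le_mul_of_nonneg_left hcard (sq_nonneg ε),
    mul_le_mul_of_nonneg_left hST.le hε]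

theorem exists_cutLE_sub_comp (n : ℕ) {D : X → X → ℝ} {ε : ℝ} (hε : 0 ≤ ε)
    (hD : ∑ x, ∑ y, D x y ^ 2 ≤ n * ε ^ 2 * (Fintype.card X : ℝ) ^ 2) :
    ∃ (P : X → Fin n → Bool × Bool) (g : (Fin n → Bool × Bool) → (Fin n → Bool × Bool) → ℝ),
      CutLE (fun x y => D x y - g (P x) (P y)) ε := by
  induction n generalizing D with
  | zero =>
    have hsq : ∀ x, 0 ≤ ∑ y, D x y ^ 2 := fun x => Finset.sum_nonneg fun _ _ => sq_nonneg _
    have hzero : ∀ x y, D x y = 0 := fun x y => by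
      have hsum : ∑ x, ∑ y, D x y ^ 2 = 0 :=
        le_antisymm (by simpa using hD) (Finset.sum_nonneg fun x _ => hsq x)
      have hx := (Finset.sum_eq_zero_iff_of_nonneg fun x _ => hsq x).1 hsum x (Finset.mem_univ x)
      exact pow_eq_zero_iff two_ne_zero |>.1
        ((Finset.sum_eq_zero_iff_of_nonneg fun _ _ => sq_nonneg _).1 hx y (Finset.mem_univ y))
    refine ⟨fun _ => Fin.elim0, 0, fun S T => ?_⟩
    simp only [hzero, Pi.zero_apply, sub_zero, Finset.sum_const_zero, abs_zero]
    positivity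
  | succ n ih =>
    by_cases hcut : CutLE D ε
    · exact ⟨fun _ _ => (false, false), 0, by simpa using hcut⟩
    · obtain ⟨S, T, c, hdec⟩ := exists_sum_sq_sub_le_of_not_cutLE hε hcut
      obtain ⟨P, g, hP⟩ := ih (hdec.trans (by push_cast at hD; linarith))
      refine ⟨fun x => Fin.cons (S x, T x) (P x),
        fun p q => (if (p 0).1 ∧ (q 0).2 then c else 0) + g (Fin.tail p) (Fin.tail q), ?_⟩
      simpa only [Fin.cons_zero, Fin.tail_cons, sub_sub] using hP

end FiniteCut

section Averaging

variable {X Y : Type*} [Fintype X] [DecidableEq Y]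

/-- The average of the matrix `D` over the block of the fibres of `P` above `p` and `q`; it is
`0` if one of these fibres is empty. -/
def fibreAverage (P : X → Y) (D : X → X → ℝ) (p q : Y) : ℝ :=
  𝔼 x with P x = p, 𝔼 y with P y = q, D x y

theorem abs_fibreAverage_le {D : X → X → ℝ} {M : ℝ} (hM : 0 ≤ M) (hD : ∀ x y, |D x y| ≤ M)
    (P : X → Y) (p q : Y) : |fibreAverage P D p q| ≤ M :=
  abs_expect_le_of_forall_abs_le hM fun x _ =>
    abs_expect_le_of_forall_abs_le hM fun y _ => hD x y

theorem fibreAverage_sub_comp (P : X → Y) (D : X → X → ℝ) (g : Y → Y → ℝ) (x y : X) :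
    fibreAverage P (fun x y => D x y - g (P x) (P y)) (P x) (P y) =
      fibreAverage P D (P x) (P y) - g (P x) (P y) := by
  have hconst : 𝔼 x' with P x' = P x, 𝔼 y' with P y' = P y, g (P x') (P y') = g (P x) (P y) := by
    rw [← Finset.expect_const (s := {x' | P x' = P x}) ⟨x, by simp⟩ (g (P x) (P y)),
      Finset.expect_congr rfl]
    intro x' hx'
    rw [← Finset.expect_const (s := {y' | P y' = P y}) ⟨y, by simp⟩ (g (P x) (P y)),
      Finset.expect_congr rfl]
    intro y' hy'
    rw [(Finset.mem_filter.1 hx').2, (Finset.mem_filter.1 hy').2]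
  simp only [fibreAverage, Finset.expect_sub_distrib, hconst]

theorem sum_expect_fibre (P : X → Y) (S : Finset X) (f : X → ℝ) :
    ∑ x ∈ S, 𝔼 x' with P x' = P x, f x' =
      ∑ x', ({x ∈ S | P x = P x'}.card / ({x | P x = P x'} : Finset X).card : ℝ) * f x' := by
  simp only [Finset.expect_eq_sum_div_card, Finset.sum_filter, Finset.sum_div]
  rw [Finset.sum_comm]
  refine Finset.sum_congr rfl fun x' _ => ?_
  rw [Finset.card_eq_sum_ones, Nat.cast_sum, Finset.sum_filter, Finset.sum_div, Finset.sum_mul]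
  refine Finset.sum_congr rfl fun x _ => ?_
  by_cases h : P x = P x'
  · simp only [h, if_true, Nat.cast_one]; ring
  · simp only [h, Ne.symm h, if_false, zero_div, zero_mul]

theorem CutLE.fibreAverage {D : X → X → ℝ} {ε : ℝ} (h : CutLE D ε) (P : X → Y) :
    CutLE (fun x y => fibreAverage P D (P x) (P y)) (4 * ε) := by
  intro S T
  have hweight : ∀ (S : Finset X) (x' : X),
      |({x ∈ S | P x = P x'}.card / ({x | P x = P x'} : Finset X).card : ℝ)| ≤ 1 := fun S x' => by
    rw [abs_of_nonneg (by positivity)]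
    exact div_le_one_of_le₀ (Nat.cast_le.2 <| Finset.card_le_card <|
      Finset.filter_subset_filter _ (Finset.subset_univ S)) (Nat.cast_nonneg _)
  have hsum : ∑ x ∈ S, ∑ y ∈ T, _root_.fibreAverage P D (P x) (P y) = ∑ x', ∑ y',
      ({x ∈ S | P x = P x'}.card / ({x | P x = P x'} : Finset X).card : ℝ) *
        ({y ∈ T | P y = P y'}.card / ({y | P y = P y'} : Finset X).card : ℝ) * D x' y' := by
    simp only [_root_.fibreAverage, ← Finset.expect_sum_comm,
      sum_expect_fibre, mul_assoc, ← Finset.mul_sum]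
  rw [hsum]
  simpa using h.abs_sum_mul_mul_le zero_le_one zero_le_one (hweight S) (hweight T)

theorem exists_bounded_cutLE_sub_comp (n : ℕ) {D : X → X → ℝ} {M ε : ℝ} (hM : 0 ≤ M) (hε : 0 ≤ ε)
    (hn : M ^ 2 ≤ n * ε ^ 2) (hD : ∀ x y, |D x y| ≤ M) :
    ∃ (P : X → Fin n → Bool × Bool) (g : (Fin n → Bool × Bool) → (Fin n → Bool × Bool) → ℝ),
      (∀ p q, |g p q| ≤ M) ∧ CutLE (fun x y => D x y - g (P x) (P y)) (5 * ε) := by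
  have henergy : ∑ x, ∑ y, D x y ^ 2 ≤ n * ε ^ 2 * (Fintype.card X : ℝ) ^ 2 :=
    calc ∑ x, ∑ y, D x y ^ 2 ≤ ∑ _x : X, ∑ _y : X, M ^ 2 :=
          Finset.sum_le_sum fun x _ => Finset.sum_le_sum fun y _ =>
            sq_le_sq' (abs_le.1 (hD x y)).1 (abs_le.1 (hD x y)).2
      _ = M ^ 2 * (Fintype.card X : ℝ) ^ 2 := by simp; ring
      _ ≤ _ := by gcongr
  obtain ⟨P, g, hcut⟩ := exists_cutLE_sub_comp n hε henergy
  refine ⟨P, fibreAverage P D, abs_fibreAverage_le hM hD P, ?_⟩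
  have hav := hcut.sub (hcut.fibreAverage P)
  simp only [fibreAverage_sub_comp, sub_sub_sub_cancel_right] at hav
  exact hav.mono (by linarith)

theorem exists_weak_regularity {C : Type*} (M : ℝ) {ε : ℝ} (hM : 0 ≤ M) (hε : 0 < ε) :
    ∃ n : ℕ, ∀ {X : Type u} [Fintype X] (U : C → X → X → ℝ), (∀ c x y, |U c x y| ≤ M) →
      ∃ (P : X → C → Fin n → Bool × Bool)
        (g : C → (C → Fin n → Bool × Bool) → (C → Fin n → Bool × Bool) → ℝ),
        (∀ c p q, |g c p q| ≤ M) ∧ ∀ c, CutLE (fun x y => U c x y - g c (P x) (P y)) ε := by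
  obtain ⟨n, hn⟩ := exists_nat_ge (M ^ 2 / (ε / 5) ^ 2)
  rw [div_le_iff₀ (by positivity)] at hn
  refine ⟨n, fun U hU => ?_⟩
  choose P g hg hcut using fun c =>
    exists_bounded_cutLE_sub_comp n hM (by positivity : 0 ≤ ε / 5) hn (hU c)
  exact ⟨fun x c => P c x, fun c p q => g c (p c) (q c), fun c p q => hg c _ _,
    fun c => (hcut c).mono (by linarith)⟩

end Averaging

section Matching

variable {X Y : Type*}

theorem exists_perm_forall_mismatch_ne [Finite X] (P Q : X → Y) :
    ∃ σ : Equiv.Perm X, ∀ x y, P (σ x) ≠ Q x → P (σ y) ≠ Q y → P (σ y) ≠ Q x := by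
  classical
  cases nonempty_fintype X
  obtain ⟨σ, -, hmin⟩ := Finset.exists_min_image (Finset.univ : Finset (Equiv.Perm X))
    (fun σ => ({x | P (σ x) ≠ Q x} : Finset X).card) Finset.univ_nonempty
  refine ⟨σ, fun x y hx hy hxy => ?_⟩
  -- otherwise exchanging `σ x` and `σ y` removes the mismatch at `x`
  refine (Finset.card_lt_card ?_).not_ge (hmin (σ * Equiv.swap x y) (Finset.mem_univ _))
  rw [Finset.ssubset_iff_of_subset]
  · refine ⟨x, by simpa using hx, fun hmem => (Finset.mem_filter.1 hmem).2 ?_⟩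
    rwa [Equiv.Perm.mul_apply, Equiv.swap_apply_left]
  · intro z hz
    replace hz := (Finset.mem_filter.1 hz).2
    rw [Equiv.Perm.mul_apply] at hz
    rw [Finset.mem_filter_univ]
    rcases eq_or_ne z x with rfl | hzx
    · exact hx
    rcases eq_or_ne z y with rfl | hzy
    · exact hy
    rwa [Equiv.swap_apply_of_ne_of_ne hzx hzy] at hz

theorem exists_perm_card_mismatch_le [Fintype X] [Fintype Y] [DecidableEq Y] (P Q : X → Y) :
    ∃ σ : Equiv.Perm X, ({x | P (σ x) ≠ Q x} : Finset X).card ≤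
      ∑ p, |(({x | P x = p} : Finset X).card : ℝ) - ({x | Q x = p} : Finset X).card| := by
  classical
  obtain ⟨σ, hσ⟩ := exists_perm_forall_mismatch_ne P Q
  refine ⟨σ, ?_⟩
  rw [Finset.card_eq_sum_card_fiberwise (f := Q) (t := Finset.univ) (by simp), Nat.cast_sum]
  refine Finset.sum_le_sum fun p _ => ?_
  rcases (({x | P (σ x) ≠ Q x} : Finset X).filter fun x => Q x = p).eq_empty_or_nonempty with
    hp | ⟨x, hx⟩
  · rw [hp, Finset.card_empty, Nat.cast_zero]
    exact abs_nonneg _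
  · simp only [Finset.mem_filter, Finset.mem_univ, true_and] at hx
    have hfibre : ({y | P y = p} : Finset X).card = ({y | P (σ y) = p} : Finset X).card :=
      (Finset.card_equiv σ (by simp)).symm
    have hsub : ({y | P (σ y) = p} : Finset X).card +
        (({y | P (σ y) ≠ Q y} : Finset X).filter fun y => Q y = p).card ≤
          ({y | Q y = p} : Finset X).card := by
      rw [← Finset.card_union_of_disjoint]
      · refine Finset.card_le_card fun y hy => ?_
        simp only [Finset.mem_union, Finset.mem_filter, Finset.mem_univ, true_and] at hy ⊢
        rcases hy with hy | hy
        · by_contra hne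
          exact hσ x y hx.1 (hy ▸ Ne.symm hne) (hy.trans hx.2.symm)
        · exact hy.2
      · rw [Finset.disjoint_left]
        simp only [Finset.mem_filter, Finset.mem_univ, true_and]
        rintro y hy ⟨hne, hQ⟩
        exact hne (hy.trans hQ.symm)
    rw [hfibre, abs_sub_comm]
    refine le_trans ?_ (le_abs_self _)
    rw [le_sub_iff_add_le']
    exact_mod_cast hsub

end Matching

section Resampling

open Finset

variable {I X : Type*} [Fintype I] [DecidableEq I] [Fintype X]

theorem expect_expect_update (h : (I → X) → ℝ) (i : I) :
    𝔼 x, 𝔼 a, h (Function.update x i a) = 𝔼 x, h x := by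
  rcases isEmpty_or_nonempty X with hX | hX
  · have : IsEmpty (I → X) := ⟨fun x => hX.elim (x i)⟩
    simp [Finset.univ_eq_empty]
  -- The involution exchanging the `i`-th coordinate with an independent sample.
  let e : (I → X) × X ≃ (I → X) × X :=
    { toFun := fun p => (Function.update p.1 i p.2, p.1 i)
      invFun := fun p => (Function.update p.1 i p.2, p.1 i)
      left_inv := fun p => by simp
      right_inv := fun p => by simp }
  calc 𝔼 x, 𝔼 a, h (Function.update x i a)
      = 𝔼 p : (I → X) × X, h (Function.update p.1 i p.2) := by
        rw [← univ_product_univ, expect_product]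
    _ = 𝔼 p : (I → X) × X, h p.1 := Fintype.expect_equiv e _ _ fun p => rfl
    _ = 𝔼 x, h x := by rw [← univ_product_univ, expect_product]; simp

theorem expect_apply_apply (h : X → X → ℝ) {i j : I} (hij : i ≠ j) :
    𝔼 x : I → X, h (x i) (x j) = 𝔼 a, 𝔼 b, h a b := by
  rcases isEmpty_or_nonempty X with hX | hX
  · have : IsEmpty (I → X) := ⟨fun x => hX.elim (x i)⟩
    simp [Finset.univ_eq_empty]
  rw [← expect_expect_update _ i, ← expect_expect_update _ j]
  simp only [Function.update_self, Function.update_of_ne hij.symm, Fintype.expect_const]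
  rw [expect_comm]

theorem expect_apply_apply_apply_apply (h : X → X → X → X → ℝ) {i i' j j' : I}
    (hnodup : [i, i', j, j'].Nodup) :
    𝔼 x : I → X, h (x i) (x i') (x j) (x j') = 𝔼 a, 𝔼 a', 𝔼 b, 𝔼 b', h a a' b b' := by
  simp only [List.nodup_cons, List.mem_cons, List.not_mem_nil, or_false, not_or] at hnodup
  obtain ⟨⟨h1, h2, h3⟩, ⟨h4, h5⟩, h6, -⟩ := hnodup
  rw [← expect_expect_update _ i]
  simp only [Function.update_self, Function.update_of_ne (Ne.symm h1),
    Function.update_of_ne (Ne.symm h2), Function.update_of_ne (Ne.symm h3)]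
  rw [expect_comm]
  refine expect_congr rfl fun a _ => ?_
  rw [← expect_expect_update _ i']
  simp only [Function.update_self, Function.update_of_ne (Ne.symm h4),
    Function.update_of_ne (Ne.symm h5)]
  rw [expect_comm]
  exact expect_congr rfl fun a' _ => expect_apply_apply (h a a') h6

theorem expect_ite_eq_one (i : I) :
    𝔼 j, (if i = j then (1 : ℝ) else 0) = 1 / Fintype.card I := by
  simp [NNRat.smul_def]

theorem expect_sq_expect_comp_le {f : X → ℝ} (hf : ∀ x, |f x| ≤ 1) (h0 : 𝔼 x, f x = 0) :
    𝔼 x : I → X, (𝔼 i, f (x i)) ^ 2 ≤ 1 / Fintype.card I := by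
  have cov : ∀ i j, 𝔼 x : I → X, f (x i) * f (x j) ≤ if i = j then 1 else 0 := by
    intro i j
    split_ifs with hij
    · refine (le_abs_self _).trans (abs_expect_le_of_forall_abs_le zero_le_one fun x _ => ?_)
      rw [abs_mul]
      exact mul_le_one₀ (hf _) (abs_nonneg _) (hf _)
    · rw [expect_apply_apply (fun a b => f a * f b) hij]
      simp [← mul_expect, h0]
  calc 𝔼 x : I → X, (𝔼 i, f (x i)) ^ 2
      = 𝔼 i, 𝔼 j, 𝔼 x : I → X, f (x i) * f (x j) := by
        simp only [sq, expect_mul_expect]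
        rw [expect_comm]
        exact expect_congr rfl fun i _ => expect_comm _ _ _
    _ ≤ 𝔼 i : I, 𝔼 j : I, if i = j then (1 : ℝ) else 0 :=
        expect_le_expect fun i _ => expect_le_expect fun j _ => cov i j
    _ ≤ 1 / Fintype.card I :=
        (le_abs_self _).trans <| abs_expect_le_of_forall_abs_le (by positivity) fun i _ => by
          rw [expect_ite_eq_one, abs_of_nonneg (by positivity)]

theorem expect_ite_not_nodup_le :
    𝔼 i : I, 𝔼 i' : I, 𝔼 j : I, 𝔼 j' : I, (if [i, i', j, j'].Nodup then (0 : ℝ) else 1) ≤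
      6 / Fintype.card I := by
  rcases isEmpty_or_nonempty I with hI | hI
  · simp
  have union_bound : ∀ i i' j j' : I, (if [i, i', j, j'].Nodup then (0 : ℝ) else 1) ≤
      (if i = i' then 1 else 0) + (if i = j then 1 else 0) + (if i = j' then 1 else 0) +
      (if i' = j then 1 else 0) + (if i' = j' then 1 else 0) + (if j = j' then 1 else 0) := by
    intro i i' j j'
    by_cases h : [i, i', j, j'].Nodup
    · rw [if_pos h]
      positivity
    rw [if_neg h]
    have : i = i' ∨ i = j ∨ i = j' ∨ i' = j ∨ i' = j' ∨ j = j' := by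
      by_contra! h'
      exact h (by simpa [and_assoc] using h')
    rcases this with rfl | rfl | rfl | rfl | rfl | rfl <;> grind
  refine (expect_le_expect fun i _ => expect_le_expect fun i' _ => expect_le_expect fun j _ =>
    expect_le_expect fun j' _ => union_bound i i' j j').trans_eq ?_
  simp only [expect_add_distrib, expect_ite_eq_one, Fintype.expect_const]
  ring

theorem expect_sum_mul_expect {Z Ω ι : Type*} [Fintype Z] [Fintype Ω] [Fintype ι]
    (w : Z → Ω → ℝ) (f : ι → Z → Ω → ℝ) :
    𝔼 z, ∑ ω, w z ω * 𝔼 i, f i z ω = 𝔼 i, 𝔼 z, ∑ ω, w z ω * f i z ω := by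
  simp only [mul_expect, ← expect_sum_comm]
  exact expect_comm _ _ _

end Resampling

theorem sum_prod_mul_prod_comp {E Ω J : Type*} [Fintype E] [DecidableEq E] [Fintype Ω] [Fintype J]
    {p : E → Ω → ℝ} (hp : ∀ e, ∑ s, p e s = 1) {e : J → E} (he : Function.Injective e)
    (g : J → Ω → ℝ) :
    ∑ ω : E → Ω, (∏ a, p a (ω a)) * ∏ j, g j (ω (e j)) = ∏ j, ∑ s, p (e j) s * g j s := by
  let G : E → Ω → ℝ := Function.extend e g fun _ _ => 1
  have hG : ∀ j, G (e j) = g j := he.extend_apply g _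
  have hG' : ∀ a, a ∉ Set.range e → G a = fun _ => 1 := fun a ha =>
    Function.extend_apply' g _ a fun h => ha h
  calc ∑ ω : E → Ω, (∏ a, p a (ω a)) * ∏ j, g j (ω (e j))
      = ∑ ω : E → Ω, ∏ a, p a (ω a) * G a (ω a) := by
        refine Finset.sum_congr rfl fun ω _ => ?_
        rw [Finset.prod_mul_distrib, Fintype.prod_of_injective e he _ (fun a => G a (ω a))
          (fun a ha => by simp [hG' a ha]) fun j => by rw [hG]]
    _ = ∏ a, ∑ s, p a s * G a s := by
        rw [Finset.prod_univ_sum, Fintype.piFinset_univ]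
    _ = ∏ j, ∑ s, p (e j) s * g j s :=
        (Fintype.prod_of_injective e he _ _ (fun a ha => by simp [hG' a ha, hp])
          fun j => by rw [hG]).symm

section Sampling

open Finset

variable {X C : Type*} {k : ℕ}

/-- The sign `±1` encoded by a Boolean. -/
def boolSign (b : Bool) : ℝ := if b then 1 else -1

theorem abs_boolSign (b : Bool) : |boolSign b| = 1 := by cases b <;> simp [boolSign]

/-- The unordered pairs of distinct sample points, each represented by its increasing ordering. -/
abbrev SamplePair (k : ℕ) : Type := {e : Fin k × Fin k // e.1 < e.2}

theorem SamplePair.sym2_injective :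
    Function.Injective fun e : SamplePair k => s(e.1.1, e.1.2) := by
  rintro ⟨⟨i, j⟩, hij⟩ ⟨⟨i', j'⟩, hlt⟩ h
  rcases Sym2.eq_iff.1 h with ⟨rfl, rfl⟩ | ⟨rfl, rfl⟩
  · rfl
  · exact absurd hij (not_lt_of_gt hlt)

/-- The sample pair with vertices `i` and `j`. -/
def SamplePair.ofNe {i j : Fin k} (h : i ≠ j) : SamplePair k :=
  if hij : i < j then ⟨(i, j), hij⟩ else ⟨(j, i), lt_of_le_of_ne (not_lt.1 hij) h.symm⟩

theorem SamplePair.sym2_ofNe {i j : Fin k} (h : i ≠ j) :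
    s((ofNe h).1.1, (ofNe h).1.2) = s(i, j) := by
  unfold ofNe
  split_ifs
  exacts [rfl, Sym2.eq_swap]

/-- The state of a sample pair: the orientation in which it is observed (`true` for increasing),
the colour of the observed kernel, and the sign of the observation. -/
abbrev PairState (C : Type*) : Type _ := Bool × C × Bool

/-- The kernel of colour `c` read along the direction `b`. -/
def directed (U : C → X → X → ℝ) (b : Bool) (c : C) (x y : X) : ℝ :=
  if b then U c x y else U c y x

/-- The probability that the pair `(x, y)` receives the state `s`: direction and colour are uniform
and the sign has conditional mean `directed U s.1 s.2.1 x y / M`. -/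
def stateWeight [Fintype C] (M : ℝ) (U : C → X → X → ℝ) (x y : X) (s : PairState C) : ℝ :=
  (1 + boolSign s.2.2 * directed U s.1 s.2.1 x y / M) / (4 * Fintype.card C)

/-- The conditional probability of the configuration `ω` given the sample `x`. -/
def configWeight [Fintype C] (M : ℝ) (U : C → X → X → ℝ) (x : Fin k → X)
    (ω : SamplePair k → PairState C) : ℝ :=
  ∏ e, stateWeight M U (x e.1.1) (x e.1.2) (ω e)

/-- The unbiased estimator of the kernel of colour `c`, read along the direction `b`, from the state
of a sample pair. -/
def estimator [Fintype C] [DecidableEq C] (M : ℝ) (c : C) (b : Bool) (s : PairState C) : ℝ :=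
  if s.1 = b ∧ s.2.1 = c then 2 * Fintype.card C * M * boolSign s.2.2 else 0

/-- The matrix of colour `c` estimated from the configuration `ω`. -/
def sampleMatrix [Fintype C] [DecidableEq C] (M : ℝ) (ω : SamplePair k → PairState C) (c : C)
    (i j : Fin k) : ℝ :=
  if h : i ≠ j then estimator M c (decide (i < j)) (ω (SamplePair.ofNe h)) else 0

variable {M : ℝ} {U : C → X → X → ℝ}

theorem abs_directed_le (hU : ∀ c x y, |U c x y| ≤ M) (b : Bool) (c : C) (x y : X) :
    |directed U b c x y| ≤ M := by
  unfold directed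
  split_ifs <;> exact hU _ _ _

variable [Fintype C]

theorem stateWeight_nonneg (hU : ∀ c x y, |U c x y| ≤ M) (x y : X) (s : PairState C) :
    0 ≤ stateWeight M U x y s := by
  have hbias : |boolSign s.2.2 * directed U s.1 s.2.1 x y / M| ≤ 1 := by
    have h := abs_directed_le hU s.1 s.2.1 x y
    rw [abs_div, abs_mul, abs_boolSign, one_mul]
    exact div_le_one_of_le₀ (h.trans (le_abs_self M)) (abs_nonneg M)
  exact div_nonneg (by linarith [(abs_le.1 hbias).1]) (by positivity)

theorem sum_stateWeight [Nonempty C] (M : ℝ) (U : C → X → X → ℝ) (x y : X) :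
    ∑ s, stateWeight M U x y s = 1 := by
  simp only [stateWeight, Fintype.sum_prod_type, Fintype.sum_bool, boolSign, if_true,
    Bool.false_eq_true, if_false]
  rw [← sum_add_distrib, sum_congr rfl fun c _ => show _ = (1 / Fintype.card C : ℝ) by
    field_simp; ring]
  simp

theorem configWeight_nonneg (hU : ∀ c x y, |U c x y| ≤ M) (x : Fin k → X)
    (ω : SamplePair k → PairState C) : 0 ≤ configWeight M U x ω :=
  prod_nonneg fun _ _ => stateWeight_nonneg hU _ _ _

theorem sum_configWeight [Nonempty C] (M : ℝ) (U : C → X → X → ℝ) (x : Fin k → X) :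
    ∑ ω, configWeight M U x ω = 1 := by
  have := sum_prod_mul_prod_comp (p := fun e : SamplePair k => stateWeight M U (x e.1.1) (x e.1.2))
    (fun e => sum_stateWeight M U _ _) (Function.injective_of_subsingleton (Empty.elim ·)) Empty.rec
  simpa [configWeight] using this

variable [DecidableEq C]

theorem sum_stateWeight_mul_estimator (hM : M ≠ 0) (x y : X) (b : Bool) (c : C) :
    ∑ s, stateWeight M U x y s * estimator M c b s = directed U b c x y := by
  have : Nonempty C := ⟨c⟩
  simp only [Fintype.sum_prod_type, Fintype.sum_bool, stateWeight, estimator, boolSign, if_true,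
    Bool.false_eq_true, if_false]
  rw [← sum_add_distrib, sum_eq_single c (fun c' _ hc' => by simp [hc']) (by simp)]
  cases b <;> simp <;> field_simp <;> ring

theorem abs_sampleMatrix_le (hM : 0 ≤ M) (ω : SamplePair k → PairState C) (c : C) (i j : Fin k) :
    |sampleMatrix M ω c i j| ≤ 2 * Fintype.card C * M := by
  unfold sampleMatrix estimator
  split_ifs
  · rw [abs_mul, abs_boolSign, mul_one, abs_of_nonneg (by positivity)]
  all_goals simp only [abs_zero]; positivity

theorem sum_stateWeight_ofNe_mul_estimator (hM : M ≠ 0) (x : Fin k → X) (c : C) {i j : Fin k}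
    (h : i ≠ j) :
    ∑ s, stateWeight M U (x (SamplePair.ofNe h).1.1) (x (SamplePair.ofNe h).1.2) s *
      estimator M c (decide (i < j)) s = U c (x i) (x j) := by
  rw [sum_stateWeight_mul_estimator hM, SamplePair.ofNe]
  split_ifs with hij <;> simp [directed, hij]

/-- Given the sample, the errors along distinct unordered pairs are independent. -/
theorem sum_configWeight_mul_prod_sub (hM : M ≠ 0) (x : Fin k → X) (c : C)
    {J : Type*} [Fintype J] {a b : J → Fin k} (hab : ∀ q, a q ≠ b q)
    (hinj : Function.Injective fun q => s(a q, b q)) (v : J → ℝ) :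
    ∑ ω, configWeight M U x ω * ∏ q, (sampleMatrix M ω c (a q) (b q) - v q) =
      ∏ q, (U c (x (a q)) (x (b q)) - v q) := by
  have : Nonempty C := ⟨c⟩
  have hinj' : Function.Injective fun q => SamplePair.ofNe (hab q) := fun q q' h => hinj <| by
    simpa only [SamplePair.sym2_ofNe] using congrArg (fun e : SamplePair k => s(e.1.1, e.1.2)) h
  let p : SamplePair k → PairState C → ℝ := fun e => stateWeight M U (x e.1.1) (x e.1.2)
  have hp : ∀ e, ∑ s, p e s = 1 := fun e => sum_stateWeight M U _ _
  have mean : ∀ q, ∑ s, p (.ofNe (hab q)) s * estimator M c (decide (a q < b q)) s =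
      U c (x (a q)) (x (b q)) := fun q => sum_stateWeight_ofNe_mul_estimator hM x c (hab q)
  have indep := sum_prod_mul_prod_comp hp hinj' fun q s =>
    estimator M c (decide (a q < b q)) s - v q
  simp only [mul_sub, sum_sub_distrib, ← sum_mul, hp, one_mul, mean] at indep
  simpa only [sampleMatrix, dif_pos (hab _), configWeight] using indep

end Sampling

section SampledFourCycle

open Finset

variable {X C : Type*} [Fintype C] [DecidableEq C] {k : ℕ} {M : ℝ} {U : C → X → X → ℝ}

/-- The error `Û_c(i, j) - V(xᵢ, xⱼ)` of the matrix estimated from the configuration `ω`. -/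
def sampleError (M : ℝ) (c : C) (V : X → X → ℝ) (x : Fin k → X) (ω : SamplePair k → PairState C)
    (i j : Fin k) : ℝ :=
  sampleMatrix M ω c i j - V (x i) (x j)

theorem abs_sampleError_le (hM : 0 ≤ M) (c : C) {V : X → X → ℝ} (hV : ∀ x y, |V x y| ≤ M)
    (x : Fin k → X) (ω : SamplePair k → PairState C) (i j : Fin k) :
    |sampleError M c V x ω i j| ≤ (2 * Fintype.card C + 1) * M := by
  refine (abs_sub _ _).trans ?_
  linarith [abs_sampleMatrix_le hM ω c i j, hV (x i) (x j)]

variable [Fintype X]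

theorem expect_sampleError_four_eq (hM : M ≠ 0) (c : C) (V : X → X → ℝ) {i i' j j' : Fin k}
    (hnodup : [i, i', j, j'].Nodup) :
    𝔼 x : Fin k → X, ∑ ω, configWeight M U x ω * (sampleError M c V x ω i j *
      sampleError M c V x ω i j' * sampleError M c V x ω i' j * sampleError M c V x ω i' j') =
    fourCycle fun x y => U c x y - V x y := by
  unfold fourCycle
  rw [← expect_apply_apply_apply_apply (fun a a' b b' => (U c a b - V a b) * (U c a b' - V a b') *
    (U c a' b - V a' b) * (U c a' b' - V a' b')) hnodup]
  refine expect_congr rfl fun x _ => ?_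
  have hne : ∀ q, ![i, i, i', i'] q ≠ ![j, j', j, j'] q := by
    intro q
    fin_cases q <;> simp_all
  have hinj : Function.Injective fun q => s(![i, i, i', i'] q, ![j, j', j, j'] q) := by
    intro q q'
    fin_cases q <;> fin_cases q' <;> simp_all [eq_comm]
  simpa [Fin.prod_univ_four, sampleError, mul_assoc] using
    sum_configWeight_mul_prod_sub (U := U) hM x c hne hinj fun q =>
      V (x (![i, i, i', i'] q)) (x (![j, j', j, j'] q))

theorem expect_sampleError_four_le [Nonempty X] (hM : 0 < M) (hU : ∀ c x y, |U c x y| ≤ M) (c : C)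
    {V : X → X → ℝ} (hV : ∀ x y, |V x y| ≤ M) (i i' j j' : Fin k) :
    𝔼 x : Fin k → X, ∑ ω, configWeight M U x ω * (sampleError M c V x ω i j *
      sampleError M c V x ω i j' * sampleError M c V x ω i' j * sampleError M c V x ω i' j') ≤
    (fourCycle fun x y => U c x y - V x y) +
      ((2 * Fintype.card C + 1) * M) ^ 4 * if [i, i', j, j'].Nodup then 0 else 1 := by
  have : Nonempty C := ⟨c⟩
  split_ifs with hnodup
  · rw [expect_sampleError_four_eq hM.ne' c V hnodup, mul_zero, add_zero]
  set B : ℝ := (2 * Fintype.card C + 1) * M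
  have hB : ∀ x ω i j, |sampleError M c V x ω i j| ≤ B := abs_sampleError_le (k := k) hM.le c hV
  calc _ ≤ 𝔼 x : Fin k → X, ∑ ω, configWeight M U x ω * B ^ 4 := by
        refine expect_le_expect fun x _ => sum_le_sum fun ω _ =>
          mul_le_mul_of_nonneg_left ((le_abs_self _).trans ?_) (configWeight_nonneg hU x ω)
        rw [abs_mul, abs_mul, abs_mul]
        calc _ ≤ B * B * B * B := by gcongr <;> exact hB _ _ _ _
          _ = B ^ 4 := by ring
    _ = B ^ 4 := by
        simp only [← sum_mul, sum_configWeight, one_mul]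
        exact Fintype.expect_const _
    _ ≤ _ := by linarith [fourCycle_nonneg fun x y => U c x y - V x y]

theorem expect_fourCycle_sampleError_le [Nonempty X] (hM : 0 < M) (hU : ∀ c x y, |U c x y| ≤ M)
    (c : C) {V : X → X → ℝ} (hV : ∀ x y, |V x y| ≤ M) (hk : 0 < k) :
    𝔼 x : Fin k → X, ∑ ω, configWeight M U x ω * fourCycle (sampleError M c V x ω) ≤
      (fourCycle fun x y => U c x y - V x y) + 6 * ((2 * Fintype.card C + 1) * M) ^ 4 / k := by
  have : Nonempty (Fin k) := ⟨⟨0, hk⟩⟩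
  simp only [fourCycle.eq_def (sampleError M c V _ _), expect_sum_mul_expect]
  refine (expect_le_expect fun i _ => expect_le_expect fun i' _ => expect_le_expect fun j _ =>
    expect_le_expect fun j' _ => expect_sampleError_four_le hM hU c hV i i' j j').trans ?_
  simp only [expect_add_distrib, Fintype.expect_const, ← mul_expect]
  grw [expect_ite_not_nodup_le]
  · rw [Fintype.card_fin]
    exact le_of_eq (by ring)

end SampledFourCycle

section Frequency

open Finset

variable {X Y : Type*} [Fintype X] [DecidableEq Y]

/-- The proportion of the points of `X` lying in the class `p` of the partition `P`. -/
def frequency (P : X → Y) (p : Y) : ℝ := 𝔼 x, if P x = p then 1 else 0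

theorem card_filter_eq_card_mul_frequency (P : X → Y) (p : Y) :
    (#{x | P x = p} : ℝ) = Fintype.card X * frequency P p := by
  rw [frequency, ← sum_boole, Fintype.card_mul_expect]

theorem frequency_mem_Icc (P : X → Y) (p : Y) : frequency P p ∈ Set.Icc (0 : ℝ) 1 := by
  have h01 : ∀ x, (if P x = p then (1 : ℝ) else 0) ∈ Set.Icc (0 : ℝ) 1 := fun x => by
    split_ifs <;> simp
  refine ⟨expect_nonneg fun x _ => (h01 x).1, (le_abs_self _).trans ?_⟩
  exact abs_expect_le_of_forall_abs_le zero_le_one fun x _ =>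
    (abs_of_nonneg (h01 x).1).trans_le (h01 x).2

theorem expect_sq_frequency_comp_sub_le {I : Type*} [Fintype I] [DecidableEq I] [Nonempty I]
    [Nonempty X] (P : X → Y) (p : Y) :
    𝔼 x : I → X, (frequency (P ∘ x) p - frequency P p) ^ 2 ≤ 1 / Fintype.card I := by
  obtain ⟨hμ0, hμ1⟩ := frequency_mem_Icc P p
  have centred : 𝔼 z, ((if P z = p then 1 else 0) - frequency P p) = 0 := by
    rw [expect_sub_distrib, Fintype.expect_const, frequency, sub_self]
  have bounded : ∀ z, |(if P z = p then 1 else 0) - frequency P p| ≤ 1 := fun z => by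
    rw [abs_le]
    split_ifs <;> constructor <;> linarith
  convert expect_sq_expect_comp_le (I := I) bounded centred using 3 with x
  rw [expect_sub_distrib, Fintype.expect_const, frequency, Function.comp_def]

end Frequency

section Moments

open Finset

/-- The density of the oriented graph `F` in a finite sample space, the edge `e` carrying the kernel
`U e`. -/
def moment {V X : Type*} [Fintype V] [DecidableEq V] [Fintype X] (F : OrientedSimpleGraph V)
    (U : V × V → X → X → ℝ) : ℝ :=
  𝔼 x : V → X, ∏ e ∈ F.edges, U e (x e.1) (x e.2)

variable {k : ℕ}

/-- The edge obtained from a sample pair by the orientation `b`. -/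
def orientPair (b : SamplePair k → Bool) (e : SamplePair k) : Fin k × Fin k :=
  if b e then e.1 else e.1.swap

theorem sym2_orientPair (b : SamplePair k → Bool) (e : SamplePair k) :
    s((orientPair b e).1, (orientPair b e).2) = s(e.1.1, e.1.2) := by
  unfold orientPair
  split_ifs
  exacts [rfl, Sym2.eq_swap]

theorem orientPair_injective (b : SamplePair k → Bool) : Function.Injective (orientPair b) :=
  fun e e' h => SamplePair.sym2_injective <| by
    simpa only [sym2_orientPair] using congrArg (fun e : Fin k × Fin k => s(e.1, e.2)) h

/-- The oriented graph with the sample pairs in `T` as edges, oriented by `b`. -/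
def orientedOfPairs (T : Finset (SamplePair k)) (b : SamplePair k → Bool) :
    OrientedSimpleGraph (Fin k) where
  edges := T.map ⟨orientPair b, orientPair_injective b⟩
  oriented := by
    simp only [Finset.mem_map, Function.Embedding.coeFn_mk]
    rintro i j ⟨e, -, he⟩ ⟨e', -, he'⟩
    have hsym : s(e.1.1, e.1.2) = s(i, j) := by rw [← sym2_orientPair b e, he]
    have hsym' : s(e'.1.1, e'.1.2) = s(j, i) := by rw [← sym2_orientPair b e', he']
    obtain rfl : e = e' := SamplePair.sym2_injective (by simp only [hsym, hsym', Sym2.eq_swap])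
    obtain rfl : i = j := congrArg Prod.fst (he.symm.trans he')
    have hlt := e.2
    simp_all

variable {X C : Type*} {M : ℝ}

/-- The colouring of the edges of the observed orientation by the observed colours. -/
def edgeColour [Nonempty C] (ω : SamplePair k → PairState C) : Fin k × Fin k → C :=
  Function.extend (orientPair fun e => (ω e).1) (fun e => (ω e).2.1)
    fun _ => Classical.arbitrary C

theorem prod_edges_orientedOfPairs [Nonempty C] (U : C → X → X → ℝ) (T : Finset (SamplePair k))
    (ω : SamplePair k → PairState C) (x : Fin k → X) :
    ∏ e ∈ (orientedOfPairs T fun e => (ω e).1).edges, U (edgeColour ω e) (x e.1) (x e.2) =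
      ∏ e ∈ T, directed U (ω e).1 (ω e).2.1 (x e.1.1) (x e.1.2) := by
  rw [orientedOfPairs, prod_map]
  refine prod_congr rfl fun e _ => ?_
  rw [Function.Embedding.coeFn_mk, edgeColour, (orientPair_injective _).extend_apply]
  unfold directed orientPair
  split_ifs <;> rfl

variable [Fintype C]

theorem configWeight_eq_sum [Nonempty C] (U : C → X → X → ℝ) (x : Fin k → X)
    (ω : SamplePair k → PairState C) :
    configWeight M U x ω = (1 / (4 * Fintype.card C)) ^ Fintype.card (SamplePair k) *
      ∑ T : Finset (SamplePair k), (∏ e ∈ T, boolSign (ω e).2.2 / M) *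
        ∏ e ∈ (orientedOfPairs T fun e => (ω e).1).edges, U (edgeColour ω e) (x e.1) (x e.2) := by
  have factor : ∀ e, stateWeight M U (x e.1.1) (x e.1.2) (ω e) = 1 / (4 * Fintype.card C) *
      (1 + boolSign (ω e).2.2 / M * directed U (ω e).1 (ω e).2.1 (x e.1.1) (x e.1.2)) := by
    intro e
    rw [stateWeight]
    ring
  simp only [configWeight, factor, prod_edges_orientedOfPairs, ← prod_mul_distrib]
  rw [prod_mul_distrib, prod_const, card_univ, prod_one_add, powerset_univ]

theorem expect_configWeight [Nonempty C] [Fintype X] (U : C → X → X → ℝ)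
    (ω : SamplePair k → PairState C) :
    𝔼 x : Fin k → X, configWeight M U x ω =
      (1 / (4 * Fintype.card C)) ^ Fintype.card (SamplePair k) *
        ∑ T : Finset (SamplePair k), (∏ e ∈ T, boolSign (ω e).2.2 / M) *
          moment (orientedOfPairs T fun e => (ω e).1) fun e => U (edgeColour ω e) := by
  simp only [configWeight_eq_sum, ← mul_expect, expect_sum_comm, moment]

theorem abs_expect_configWeight_sub_le [Nonempty C] [Fintype X] (hM : 0 < M) {U U' : C → X → X → ℝ}
    {η : ℝ}
    (h : ∀ (F : OrientedSimpleGraph (Fin k)) (c : Fin k × Fin k → C),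
      |moment F (fun e => U (c e)) - moment F (fun e => U' (c e))| ≤ η)
    (ω : SamplePair k → PairState C) :
    |𝔼 x : Fin k → X, configWeight M U x ω - 𝔼 x : Fin k → X, configWeight M U' x ω| ≤
      (∑ T : Finset (SamplePair k), (1 / M) ^ #T) * η := by
  have hle_one : (1 / (4 * Fintype.card C) : ℝ) ^ Fintype.card (SamplePair k) ≤ 1 := by
    refine pow_le_one₀ (by positivity) ((div_le_one (by positivity)).2 ?_)
    have : (1 : ℝ) ≤ Fintype.card C := by exact_mod_cast Fintype.card_pos
    linarith
  rw [expect_configWeight, expect_configWeight, ← mul_sub, ← sum_sub_distrib, abs_mul,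
    abs_of_nonneg (by positivity)]
  refine (mul_le_of_le_one_left (abs_nonneg _) hle_one).trans ?_
  rw [sum_mul]
  refine (abs_sum_le_sum_abs _ _).trans (sum_le_sum fun T _ => ?_)
  have hsign : ∏ e ∈ T, |boolSign (ω e).2.2 / M| = (1 / M) ^ #T := by
    simp [abs_div, abs_boolSign, abs_of_pos hM]
  rw [← mul_sub, abs_mul, abs_prod, hsign]
  exact mul_le_mul_of_nonneg_left (h _ _) (by positivity)

end Moments

section FiniteInverseCounting

open Finset

theorem mul_sum_expect_le_expect_sum_mul {Z Ω : Type*} [Fintype Z] [Fintype Ω]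
    {w D : Z → Ω → ℝ} (hw : ∀ z ω, 0 ≤ w z ω) (hD : ∀ z ω, 0 ≤ D z ω) {A : Finset Ω} {γ : ℝ}
    (hA : ∀ ω ∈ A, ∀ z, γ ≤ D z ω) :
    γ * ∑ ω ∈ A, 𝔼 z, w z ω ≤ 𝔼 z, ∑ ω, w z ω * D z ω := by
  rw [← expect_sum_comm, mul_expect]
  refine expect_le_expect fun z _ => ?_
  calc γ * ∑ ω ∈ A, w z ω = ∑ ω ∈ A, w z ω * γ := by rw [mul_comm, sum_mul]
    _ ≤ ∑ ω ∈ A, w z ω * D z ω :=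
      sum_le_sum fun ω hω => mul_le_mul_of_nonneg_left (hA ω hω z) (hw z ω)
    _ ≤ ∑ ω, w z ω * D z ω := sum_le_univ_sum_of_nonneg fun ω => mul_nonneg (hw z ω) (hD z ω)

theorem exists_common_outcome {Z Ω : Type*} [Fintype Z] [Nonempty Z] [Fintype Ω]
    {w w' D D' : Z → Ω → ℝ} (hw : ∀ z ω, 0 ≤ w z ω) (hw' : ∀ z ω, 0 ≤ w' z ω)
    (hsum : ∀ z, ∑ ω, w z ω = 1) (hD : ∀ z ω, 0 ≤ D z ω) (hD' : ∀ z ω, 0 ≤ D' z ω) {γ η : ℝ}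
    (hγ : 0 < γ) (hE : 𝔼 z, ∑ ω, w z ω * D z ω ≤ γ / 4)
    (hE' : 𝔼 z, ∑ ω, w' z ω * D' z ω ≤ γ / 4)
    (hη : ∀ ω, |𝔼 z, w z ω - 𝔼 z, w' z ω| ≤ η) (hcard : Fintype.card Ω * η ≤ 1 / 4) :
    ∃ ω z z', D z ω ≤ γ ∧ D' z' ω ≤ γ := by
  classical
  by_contra! hcon
  set A : Finset Ω := {ω | ∀ z, γ < D z ω} with hA
  have hA_le : γ * ∑ ω ∈ A, 𝔼 z, w z ω ≤ γ / 4 :=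
    (mul_sum_expect_le_expect_sum_mul hw hD fun ω hω z => ((mem_filter.1 hω).2 z).le).trans hE
  have hAc_le : γ * ∑ ω ∈ Aᶜ, 𝔼 z, w' z ω ≤ γ / 4 := by
    refine (mul_sum_expect_le_expect_sum_mul hw' hD' fun ω hω z' => ?_).trans hE'
    obtain ⟨z, hz⟩ : ∃ z, D z ω ≤ γ := by simpa [hA] using hω
    exact (hcon ω z z' hz).le
  have hdiff : ∑ ω ∈ Aᶜ, (𝔼 z, w z ω - 𝔼 z, w' z ω) ≤ 1 / 4 := by
    calc _ ≤ ∑ ω ∈ Aᶜ, |𝔼 z, w z ω - 𝔼 z, w' z ω| := sum_le_sum fun _ _ => le_abs_self _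
      _ ≤ ∑ ω, |𝔼 z, w z ω - 𝔼 z, w' z ω| := sum_le_univ_sum_of_nonneg fun _ => abs_nonneg _
      _ ≤ Fintype.card Ω * η := by simpa using sum_le_card_nsmul univ _ η fun ω _ => hη ω
      _ ≤ 1 / 4 := hcard
  have htotal : ∑ ω ∈ A, 𝔼 z, w z ω + ∑ ω ∈ Aᶜ, 𝔼 z, w z ω = 1 := by
    rw [sum_add_sum_compl, ← expect_sum_comm]
    simp only [hsum, Fintype.expect_const]
  rw [sum_sub_distrib] at hdiff
  nlinarith

variable {X Y I : Type*} [Fintype X] [Fintype I]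

/-- The map `π` pushes the uniform distribution on `X` forward to the uniform distribution on `I`.
Such maps blow up finite samples to the size of the space they were drawn from. -/
def IsEquidistributed (π : X → I) : Prop :=
  ∀ h : I → ℝ, 𝔼 x, h (π x) = 𝔼 i, h i

theorem IsEquidistributed.fourCycle_comp {π : X → I} (hπ : IsEquidistributed π) (D : I → I → ℝ) :
    (fourCycle fun x y => D (π x) (π y)) = fourCycle D := by
  have inner (a a' : I) : 𝔼 y, 𝔼 y', D a (π y) * D a (π y') * D a' (π y) * D a' (π y') =
      𝔼 b, 𝔼 b', D a b * D a b' * D a' b * D a' b' := by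
    rw [hπ fun b => 𝔼 y', D a b * D a (π y') * D a' b * D a' (π y')]
    exact expect_congr rfl fun b _ => hπ fun b' => D a b * D a b' * D a' b * D a' b'
  simp only [fourCycle, inner]
  rw [hπ fun a => 𝔼 x', 𝔼 b, 𝔼 b', D a b * D a b' * D (π x') b * D (π x') b']
  exact expect_congr rfl fun a _ => hπ fun a' => 𝔼 b, 𝔼 b', D a b * D a b' * D a' b * D a' b'

variable [DecidableEq Y]

theorem IsEquidistributed.frequency_comp {π : X → I} (hπ : IsEquidistributed π) (Q : I → Y) :
    frequency (fun x => Q (π x)) = frequency Q :=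
  funext fun p => hπ fun i => if Q i = p then 1 else 0

theorem cutLE_sub_comp_of_card_mismatch_le {P Q : X → Y} {g : Y → Y → ℝ} {M τ : ℝ} (hM : 0 ≤ M)
    (hg : ∀ p q, |g p q| ≤ M) (hPQ : (#{x | P x ≠ Q x} : ℝ) ≤ τ * Fintype.card X) :
    CutLE (fun x y => g (P x) (P y) - g (Q x) (Q y)) (4 * M * τ) := by
  refine CutLE.of_sum_abs ?_
  let mismatch (x : X) : ℝ := if P x ≠ Q x then 1 else 0
  have pointwise (x y : X) :
      |g (P x) (P y) - g (Q x) (Q y)| ≤ 2 * M * (mismatch x + mismatch y) := by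
    have h2M : |g (P x) (P y) - g (Q x) (Q y)| ≤ 2 * M :=
      (abs_sub _ _).trans (by linarith [hg (P x) (P y), hg (Q x) (Q y)])
    by_cases hx : P x = Q x <;> by_cases hy : P y = Q y <;> simp [mismatch, hx, hy] at h2M ⊢ <;>
      linarith
  have hcount : ∑ x, mismatch x = #{x | P x ≠ Q x} := sum_boole _ _
  calc ∑ x, ∑ y, |g (P x) (P y) - g (Q x) (Q y)|
      ≤ ∑ x, ∑ y, 2 * M * (mismatch x + mismatch y) :=
        sum_le_sum fun x _ => sum_le_sum fun y _ => pointwise x y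
    _ = 4 * M * Fintype.card X * #{x | P x ≠ Q x} := by
        simp only [← mul_sum, sum_add_distrib, hcount, sum_const, card_univ, nsmul_eq_mul]
        ring
    _ ≤ 4 * M * Fintype.card X * (τ * Fintype.card X) := by gcongr
    _ = 4 * M * τ * Fintype.card X ^ 2 := by ring

variable [Fintype Y]

theorem exists_perm_cutLE_of_frequency {P Q : X → Y} {τ : ℝ}
    (h : ∑ p, |frequency Q p - frequency P p| ≤ τ) :
    ∃ σ : Equiv.Perm X, ∀ {M : ℝ} {g : Y → Y → ℝ}, 0 ≤ M → (∀ p q, |g p q| ≤ M) →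
      CutLE (fun x y => g (P (σ x)) (P (σ y)) - g (Q x) (Q y)) (4 * M * τ) := by
  obtain ⟨σ, hσ⟩ := exists_perm_card_mismatch_le P Q
  refine ⟨σ, fun hM hg => cutLE_sub_comp_of_card_mismatch_le (P := fun x => P (σ x)) hM hg ?_⟩
  calc _ ≤ ∑ p, |(#{x | P x = p} : ℝ) - #{x | Q x = p}| := hσ
    _ = Fintype.card X * ∑ p, |frequency Q p - frequency P p| := by
      rw [mul_sum]
      refine sum_congr rfl fun p _ => ?_
      rw [card_filter_eq_card_mul_frequency, card_filter_eq_card_mul_frequency, ← mul_sub, abs_mul,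
        Nat.abs_cast, abs_sub_comm]
    _ ≤ τ * Fintype.card X := by rw [mul_comm]; gcongr

theorem expect_sq_sum_abs_frequency_sub_le [DecidableEq I] [Nonempty I] [Nonempty X] (P : X → Y) :
    𝔼 x : I → X, (∑ p, |frequency (P ∘ x) p - frequency P p|) ^ 2 ≤
      Fintype.card Y ^ 2 / Fintype.card I := by
  calc _ ≤ 𝔼 x : I → X, (Fintype.card Y : ℝ) * ∑ p, (frequency (P ∘ x) p - frequency P p) ^ 2 := by
        refine expect_le_expect fun x _ => ?_
        simpa only [sq_abs, card_univ] using
          sq_sum_le_card_mul_sum_sq (s := univ)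
            (f := fun p => |frequency (P ∘ x) p - frequency P p|)
    _ = Fintype.card Y * ∑ p, 𝔼 x : I → X, (frequency (P ∘ x) p - frequency P p) ^ 2 := by
        rw [← mul_expect, expect_sum_comm]
    _ ≤ Fintype.card Y * ∑ _p : Y, 1 / (Fintype.card I : ℝ) := by
        gcongr with p
        exact expect_sq_frequency_comp_sub_le P p
    _ = _ := by
        rw [sum_const, card_univ, nsmul_eq_mul]
        ring

variable {C : Type*} [Fintype C] [DecidableEq C] {k : ℕ} {M : ℝ} {U : C → X → X → ℝ}

/-- How badly the configuration `ω`, drawn along the sample `x`, represents the step kernels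
`g c (P x) (P y)`: the four-cycle norms of the errors of the estimated matrices, plus the squared
total variation error of the class frequencies. -/
def discrepancy (M : ℝ) (P : X → Y) (g : C → Y → Y → ℝ) (x : Fin k → X)
    (ω : SamplePair k → PairState C) : ℝ :=
  ∑ c, fourCycle (sampleError M c (fun x y => g c (P x) (P y)) x ω) +
    (∑ p, |frequency (P ∘ x) p - frequency P p|) ^ 2

theorem discrepancy_nonneg (M : ℝ) (P : X → Y) (g : C → Y → Y → ℝ) (x : Fin k → X)
    (ω : SamplePair k → PairState C) : 0 ≤ discrepancy M P g x ω :=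
  add_nonneg (sum_nonneg fun _ _ => fourCycle_nonneg _) (sq_nonneg _)

theorem expect_discrepancy_le [Nonempty X] [Nonempty C] (hM : 0 < M)
    (hU : ∀ c x y, |U c x y| ≤ M) (P : X → Y) {g : C → Y → Y → ℝ} (hg : ∀ c p q, |g c p q| ≤ M)
    {τ : ℝ} (hτ : ∀ c, (fourCycle fun x y => U c x y - g c (P x) (P y)) ≤ τ) (hk : 0 < k) :
    𝔼 x : Fin k → X, ∑ ω, configWeight M U x ω * discrepancy M P g x ω ≤
      Fintype.card C * τ + (Fintype.card C * (6 * ((2 * Fintype.card C + 1) * M) ^ 4) +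
        Fintype.card Y ^ 2) / k := by
  have : Nonempty (Fin k) := ⟨0, hk⟩
  have hcycles (c : C) : 𝔼 x : Fin k → X, ∑ ω, configWeight M U x ω *
      fourCycle (sampleError M c (fun x y => g c (P x) (P y)) x ω) ≤
        τ + 6 * ((2 * Fintype.card C + 1) * M) ^ 4 / k :=
    (expect_fourCycle_sampleError_le hM hU c (fun _ _ => hg c _ _) hk).trans (by grw [hτ c])
  have hfrequencies := expect_sq_sum_abs_frequency_sub_le (I := Fin k) P
  rw [Fintype.card_fin] at hfrequencies
  calc _ = ∑ c, 𝔼 x : Fin k → X, ∑ ω, configWeight M U x ω *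
          fourCycle (sampleError M c (fun x y => g c (P x) (P y)) x ω) +
        𝔼 x : Fin k → X, (∑ p, |frequency (P ∘ x) p - frequency P p|) ^ 2 := by
        rw [← expect_sum_comm, ← expect_add_distrib]
        refine expect_congr rfl fun x _ => ?_
        simp only [discrepancy, mul_add, sum_add_distrib, mul_sum, ← sum_mul, sum_configWeight,
          one_mul]
        rw [sum_comm]
    _ ≤ ∑ _c : C, (τ + 6 * ((2 * Fintype.card C + 1) * M) ^ 4 / k) + Fintype.card Y ^ 2 / k :=
        add_le_add (sum_le_sum fun c _ => hcycles c) hfrequencies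
    _ = _ := by
        rw [sum_const, card_univ, nsmul_eq_mul]
        ring

theorem exists_perm_cutLE_of_discrepancy (hM : 0 ≤ M) {π : X → Fin k}
    (hπ : IsEquidistributed π) {P : X → Y} {g : C → Y → Y → ℝ} (hg : ∀ c p q, |g c p q| ≤ M)
    {a δ : ℝ} (ha : 0 ≤ a) (haM : 4 * M * a ≤ 1)
    (hcut : ∀ c, CutLE (fun x y => U c x y - g c (P x) (P y)) δ) {x : Fin k → X}
    {ω : SamplePair k → PairState C} (hdis : discrepancy M P g x ω ≤ a ^ 4) :
    ∃ σ : Equiv.Perm X, ∀ c,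
      CutLE (fun y y' => U c (σ y) (σ y') - sampleMatrix M ω c (π y) (π y')) (δ + 2 * a) := by
  have hcycle (c : C) : fourCycle (sampleError M c (fun x y => g c (P x) (P y)) x ω) ≤ a ^ 4 :=
    (single_le_sum (f := fun c => fourCycle (sampleError M c (fun x y => g c (P x) (P y)) x ω))
      (fun c _ => fourCycle_nonneg _) (mem_univ c)).trans
      ((le_add_of_nonneg_right (sq_nonneg _)).trans hdis)
  have hfrequencies : ∑ p, |frequency (fun y => P (x (π y))) p - frequency P p| ≤ a ^ 2 := by
    rw [hπ.frequency_comp fun i => P (x i)]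
    refine le_of_sq_le_sq ?_ (sq_nonneg a)
    rw [← pow_mul]
    exact (le_add_of_nonneg_left (sum_nonneg fun _ _ => fourCycle_nonneg _)).trans hdis
  obtain ⟨σ, hσ⟩ := exists_perm_cutLE_of_frequency hfrequencies
  refine ⟨σ, fun c => ?_⟩
  have hsample : CutLE (fun y y' =>
      sampleError M c (fun x y => g c (P x) (P y)) x ω (π y) (π y')) a :=
    CutLE.of_fourCycle_le ha ((hπ.fourCycle_comp _).trans_le (hcycle c))
  convert ((((hcut c).comp_perm σ).add (hσ hM (hg c))).sub hsample).mono ?_ using 3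
  · rw [sampleError]
    ring
  · nlinarith

theorem exists_expect_discrepancy_le (C : Type*) [Fintype C] [DecidableEq C] [Nonempty C]
    {M δ γ : ℝ} (hM : 0 < M) (hδ : 0 < δ) (hγ : 0 < γ) :
    ∃ n k : ℕ, 0 < k ∧ ∀ {X : Type u} [Fintype X] [Nonempty X] {U : C → X → X → ℝ},
      (∀ c x y, |U c x y| ≤ M) →
      ∃ (P : X → C → Fin n → Bool × Bool)
        (g : C → (C → Fin n → Bool × Bool) → (C → Fin n → Bool × Bool) → ℝ),
        (∀ c p q, |g c p q| ≤ M) ∧ (∀ c, CutLE (fun x y => U c x y - g c (P x) (P y)) δ) ∧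
        𝔼 x : Fin k → X, ∑ ω, configWeight M U x ω * discrepancy M P g x ω ≤ γ := by
  set δ' : ℝ := min δ (γ / (2 * (Fintype.card C * (4 * (2 * M) ^ 3)))) with hδ'
  have hδ'_pos : 0 < δ' := by positivity
  obtain ⟨n, hn⟩ := exists_weak_regularity.{u} (C := C) M hM.le hδ'_pos
  set N : ℝ := Fintype.card C * (6 * ((2 * Fintype.card C + 1) * M) ^ 4) +
    Fintype.card (C → Fin n → Bool × Bool) ^ 2
  obtain ⟨k, hk⟩ := exists_nat_gt (2 * N / γ)
  have hk_pos : (0 : ℝ) < k := lt_of_le_of_lt (by positivity) hk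
  refine ⟨n, k, by exact_mod_cast hk_pos, fun {X} _ _ {U} hU => ?_⟩
  obtain ⟨P, g, hg, hcut⟩ := hn U hU
  refine ⟨P, g, hg, fun c => (hcut c).mono (min_le_left _ _), ?_⟩
  have hcycle (c : C) : (fourCycle fun x y => U c x y - g c (P x) (P y)) ≤ 4 * (2 * M) ^ 3 * δ' :=
    (hcut c).fourCycle_le hδ'_pos.le (by positivity) fun x y =>
      (abs_sub _ _).trans (by linarith [hU c x y, hg c (P x) (P y)])
  have hregularity : Fintype.card C * (4 * (2 * M) ^ 3 * δ') ≤ γ / 2 := by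
    grw [hδ', min_le_right]
    exact le_of_eq (by field_simp)
  have hsampling : N / k ≤ γ / 2 := by
    rw [div_lt_iff₀ hγ] at hk
    rw [div_le_iff₀ hk_pos]
    linarith
  linarith [expect_discrepancy_le hM hU P hg hcycle (by exact_mod_cast hk_pos : 0 < k)]

theorem exists_perm_cutLE_of_moment (C : Type*) [Finite C] {M ε : ℝ} (hM : 0 < M) (hε : 0 < ε) :
    ∃ k : ℕ, 0 < k ∧ ∃ η : ℝ, 0 < η ∧ ∀ {X : Type u} [Fintype X] [Nonempty X] {π : X → Fin k},
      IsEquidistributed π → ∀ {U U' : C → X → X → ℝ},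
      (∀ c x y, |U c x y| ≤ M) → (∀ c x y, |U' c x y| ≤ M) →
      (∀ (F : OrientedSimpleGraph (Fin k)) (c : Fin k × Fin k → C),
        |moment F (fun e => U (c e)) - moment F (fun e => U' (c e))| ≤ η) →
      ∃ σ : Equiv.Perm X, ∀ c, CutLE (fun x y => U c x y - U' c (σ x) (σ y)) ε := by
  classical
  cases nonempty_fintype C
  rcases isEmpty_or_nonempty C with hC | hC
  · exact ⟨1, one_pos, 1, one_pos, fun _ _ _ _ _ _ => ⟨1, fun c => hC.elim c⟩⟩
  set a : ℝ := min (ε / 6) (1 / (4 * M)) with ha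
  have ha_pos : 0 < a := by positivity
  have haM : 4 * M * a ≤ 1 := by
    grw [ha, min_le_right]
    exact le_of_eq (by field_simp)
  obtain ⟨n, k, hk, hreg⟩ := exists_expect_discrepancy_le.{u} C hM (by positivity : 0 < ε / 6)
    (by positivity : 0 < a ^ 4 / 4)
  set K : ℝ := Fintype.card (SamplePair k → PairState C) *
    ∑ T : Finset (SamplePair k), (1 / M) ^ #T with hK
  have hK_nonneg : 0 ≤ K := by positivity
  refine ⟨k, hk, 1 / (4 * (K + 1)), by positivity, fun {X} _ _ {π} hπ {U U'} hU hU' hmom => ?_⟩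
  obtain ⟨P, g, hg, hcut, hE⟩ := hreg hU
  obtain ⟨P', g', hg', hcut', hE'⟩ := hreg hU'
  obtain ⟨ω, x, x', hx, hx'⟩ := exists_common_outcome (configWeight_nonneg hU)
    (configWeight_nonneg hU') (sum_configWeight M U) (discrepancy_nonneg M P g)
    (discrepancy_nonneg M P' g') (by positivity) hE hE'
    (abs_expect_configWeight_sub_le hM hmom) <| by
      rw [← mul_assoc, ← hK, mul_one_div, div_le_iff₀ (by positivity)]
      linarith
  obtain ⟨σ, hσ⟩ := exists_perm_cutLE_of_discrepancy hM.le hπ hg ha_pos.le haM hcut hx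
  obtain ⟨σ', hσ'⟩ := exists_perm_cutLE_of_discrepancy hM.le hπ hg' ha_pos.le haM hcut' hx'
  refine ⟨σ' * σ⁻¹, fun c => ?_⟩
  have hε' : ε / 6 + 2 * a ≤ ε / 2 := by linarith [min_le_left (ε / 6) (1 / (4 * M))]
  convert (((hσ c).sub (hσ' c)).comp_perm σ⁻¹).mono (by linarith : _ ≤ ε) using 3
  simp

end FiniteInverseCounting

section FiniteCounting

open Finset

theorem abs_prod_le_pow {ι : Type*} (s : Finset ι) {f : ι → ℝ} {M : ℝ} {n : ℕ} (hM : 1 ≤ M)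
    (hf : ∀ e ∈ s, |f e| ≤ M) (hn : s.card ≤ n) : |∏ e ∈ s, f e| ≤ M ^ n := by
  rw [abs_prod]
  calc ∏ e ∈ s, |f e| ≤ ∏ _e ∈ s, M := prod_le_prod (fun _ _ => abs_nonneg _) hf
    _ = M ^ s.card := prod_const M
    _ ≤ M ^ n := pow_le_pow_right₀ hM hn

variable {X V : Type*} [DecidableEq V]

theorem prod_update_update {F : OrientedSimpleGraph V} {i j : V} (hij : (i, j) ∈ F.edges)
    (A : V × V → X → X → ℝ) (x : V → X) (a b : X) :
    ∏ e ∈ F.edges.erase (i, j), A e (Function.update (Function.update x j b) i a e.1)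
        (Function.update (Function.update x j b) i a e.2) =
      (∏ e ∈ F.edges.erase (i, j) with e.1 = i ∨ e.2 = i,
        A e (Function.update x i a e.1) (Function.update x i a e.2)) *
      ∏ e ∈ F.edges.erase (i, j) with ¬(e.1 = i ∨ e.2 = i),
        A e (Function.update x j b e.1) (Function.update x j b e.2) := by
  have hne : i ≠ j := by
    rintro rfl
    exact F.oriented i i hij hij
  -- An edge at `i` other than `(i, j)` misses `j`, because `(j, i)` is not an edge.
  have hmiss : ∀ e ∈ F.edges.erase (i, j), (e.1 = i ∨ e.2 = i) → e.1 ≠ j ∧ e.2 ≠ j := by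
    have := F.oriented i j hij
    grind
  rw [← prod_filter_mul_prod_filter_not (F.edges.erase (i, j)) fun e => e.1 = i ∨ e.2 = i]
  congr 1
  · refine prod_congr rfl fun e he => ?_
    obtain ⟨h1, h2⟩ := hmiss e (mem_filter.1 he).1 (mem_filter.1 he).2
    rw [Function.update_comm hne.symm, Function.update_of_ne h1, Function.update_of_ne h2]
  · refine prod_congr rfl fun e he => ?_
    obtain ⟨h1, h2⟩ := not_or.1 (mem_filter.1 he).2
    rw [Function.update_of_ne h1, Function.update_of_ne h2]

variable [Fintype X] [Fintype V]

theorem CutLE.abs_expect_mul_prod_le {F : OrientedSimpleGraph V} {i j : V}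
    (hij : (i, j) ∈ F.edges) {D : X → X → ℝ} {ε M : ℝ} (hD : CutLE D ε) (hε : 0 ≤ ε) (hM : 1 ≤ M)
    {A : V × V → X → X → ℝ} (hA : ∀ e ∈ F.edges, ∀ x y, |A e x y| ≤ M) :
    |𝔼 x : V → X, D (x i) (x j) * ∏ e ∈ F.edges.erase (i, j), A e (x e.1) (x e.2)| ≤
      4 * M ^ F.edges.card * M ^ F.edges.card * ε := by
  have hne : i ≠ j := by
    rintro rfl
    exact F.oriented i i hij hij
  have hbound : ∀ (x : V → X) (p : V × V → Prop) [DecidablePred p],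
      |∏ e ∈ F.edges.erase (i, j) with p e, A e (x e.1) (x e.2)| ≤ M ^ F.edges.card :=
    fun x p _ => abs_prod_le_pow _ hM
      (fun e he => hA e (mem_of_mem_erase (mem_filter.1 he).1) _ _)
      ((card_filter_le _ _).trans (card_le_card (erase_subset _ _)))
  rw [← expect_expect_update _ i, ← expect_expect_update _ j]
  refine abs_expect_le_of_forall_abs_le (by positivity) fun x _ => ?_
  simp only [prod_update_update hij, Function.update_self, Function.update_of_ne hne.symm]
  rw [expect_comm]
  simpa only [mul_comm (D _ _)] using hD.abs_expect_mul_mul_le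
    (a := M ^ F.edges.card) (b := M ^ F.edges.card) (by positivity) (by positivity)
    (fun a => hbound (Function.update x i a) fun e => e.1 = i ∨ e.2 = i)
    (fun b => hbound (Function.update x j b) fun e => ¬(e.1 = i ∨ e.2 = i)) hε

theorem moment_update_sub (F : OrientedSimpleGraph V) {e : V × V} (he : e ∈ F.edges)
    (U : V × V → X → X → ℝ) (A : X → X → ℝ) :
    moment F (Function.update U e A) - moment F U =
      𝔼 x : V → X, (A (x e.1) (x e.2) - U e (x e.1) (x e.2)) *
        ∏ e' ∈ F.edges.erase e, U e' (x e'.1) (x e'.2) := by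
  simp only [moment, ← expect_sub_distrib]
  refine expect_congr rfl fun x _ => ?_
  rw [← mul_prod_erase _ _ he, ← mul_prod_erase _ _ he, sub_mul, Function.update_self]
  congr 2
  refine prod_congr rfl fun e' he' => ?_
  rw [Function.update_of_ne (ne_of_mem_erase he')]

theorem abs_moment_sub_le (F : OrientedSimpleGraph V) {U U' : V × V → X → X → ℝ} {ε M : ℝ}
    (hε : 0 ≤ ε) (hM : 1 ≤ M) (hU : ∀ e ∈ F.edges, ∀ x y, |U e x y| ≤ M)
    (hU' : ∀ e ∈ F.edges, ∀ x y, |U' e x y| ≤ M)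
    (hcut : ∀ e ∈ F.edges, CutLE (fun x y => U e x y - U' e x y) ε) :
    |moment F U - moment F U'| ≤
      F.edges.card * (4 * M ^ F.edges.card * M ^ F.edges.card * ε) := by
  -- Exchange the kernels one edge at a time.
  have hexchange : ∀ S ⊆ F.edges, |moment F (S.piecewise U U') - moment F U'| ≤
      S.card * (4 * M ^ F.edges.card * M ^ F.edges.card * ε) := by
    intro S
    induction S using Finset.induction_on with
    | empty => simp
    | insert e S heS ih =>
      intro hS
      obtain ⟨heF, hSF⟩ := insert_subset_iff.1 hS
      have hstep := (hcut e heF).abs_expect_mul_prod_le (i := e.1) (j := e.2) heF hε hM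
        (A := S.piecewise U U') fun e' he' x y => by
          by_cases h : e' ∈ S <;> simp [h, hU, hU', he']
      have hdiff := moment_update_sub F heF (S.piecewise U U') (U e)
      rw [piecewise_eq_of_notMem _ _ _ heS] at hdiff
      rw [Prod.mk.eta, ← hdiff, ← piecewise_insert] at hstep
      rw [card_insert_of_notMem heS, Nat.cast_succ, add_one_mul, add_comm]
      exact (abs_sub_le _ _ _).trans (add_le_add hstep (ih hSF))
  have hall : moment F (F.edges.piecewise U U') = moment F U :=
    expect_congr rfl fun x _ => prod_congr rfl fun e he => by
      rw [piecewise_eq_of_mem _ _ _ he]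
  simpa only [hall] using hexchange F.edges subset_rfl

end FiniteCounting

section Cells

variable {N : ℕ} [NeZero N]

/-- The index of the cell `[i/N, (i+1)/N)` containing `x` (irrelevant at `x = 1`). -/
def cell (N : ℕ) [NeZero N] (x : unitInterval) : Fin N := Fin.ofNat N ⌊(N : ℝ) * x⌋₊

theorem measurable_cell : Measurable (cell N) :=
  (measurable_from_top (f := Fin.ofNat N)).comp
    (Measurable.nat_floor (measurable_const.mul measurable_subtype_coe))

theorem floor_lt_of_ne_one {x : unitInterval} (hx : x ≠ 1) : ⌊(N : ℝ) * x⌋₊ < N := by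
  have hN : (0 : ℝ) < N := Nat.cast_pos.2 (NeZero.pos N)
  rw [Nat.floor_lt (mul_nonneg hN.le x.2.1)]
  have h1 : (x : ℝ) < 1 := lt_of_le_of_ne x.2.2 fun h => hx (Subtype.ext h)
  nlinarith

theorem cell_val {x : unitInterval} (hx : x ≠ 1) : (cell N x : ℕ) = ⌊(N : ℝ) * x⌋₊ :=
  Nat.mod_eq_of_lt (floor_lt_of_ne_one hx)

theorem cell_le {x : unitInterval} (hx : x ≠ 1) : (cell N x : ℝ) ≤ N * x := by
  rw [cell_val hx]
  exact Nat.floor_le (mul_nonneg (Nat.cast_nonneg _) x.2.1)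

theorem lt_cell_add_one {x : unitInterval} (hx : x ≠ 1) : N * (x : ℝ) < cell N x + 1 := by
  rw [cell_val hx]
  exact Nat.lt_floor_add_one _

theorem cell_eq_of_mem {x : unitInterval} (hx : x ≠ 1) {i : Fin N} (h1 : (i : ℝ) ≤ N * x)
    (h2 : N * (x : ℝ) < i + 1) : cell N x = i := by
  apply Fin.ext
  rw [cell_val hx, Nat.floor_eq_iff (mul_nonneg (Nat.cast_nonneg _) x.2.1)]
  exact ⟨h1, h2⟩

theorem shift_mem (σ : Equiv.Perm (Fin N)) {x : unitInterval} (hx : x ≠ 1) :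
    0 ≤ (x : ℝ) + ((σ (cell N x) : ℝ) - cell N x) / N ∧
      (x : ℝ) + ((σ (cell N x) : ℝ) - cell N x) / N < 1 := by
  have hN : (0 : ℝ) < N := Nat.cast_pos.2 (NeZero.pos N)
  have e : (x : ℝ) + ((σ (cell N x) : ℝ) - cell N x) / N =
      (N * x - cell N x + σ (cell N x)) / N := by field_simp; ring
  have h1 := cell_le (N := N) hx
  have h2 := lt_cell_add_one (N := N) hx
  have h3 : (σ (cell N x) : ℝ) + 1 ≤ N := by exact_mod_cast (σ (cell N x)).2
  rw [e, div_lt_one hN]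
  exact ⟨div_nonneg (by linarith) hN.le, by linarith⟩

/-- The interval exchange translating the cell `i` onto the cell `σ i`. -/
def cellPerm (σ : Equiv.Perm (Fin N)) (x : unitInterval) : unitInterval :=
  if hx : x = 1 then 1 else
    ⟨(x : ℝ) + ((σ (cell N x) : ℝ) - cell N x) / N, (shift_mem σ hx).1, (shift_mem σ hx).2.le⟩

theorem coe_cellPerm (σ : Equiv.Perm (Fin N)) {x : unitInterval} (hx : x ≠ 1) :
    (cellPerm σ x : ℝ) = x + ((σ (cell N x) : ℝ) - cell N x) / N := by
  rw [cellPerm, dif_neg hx]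

theorem cellPerm_one (σ : Equiv.Perm (Fin N)) : cellPerm σ 1 = 1 := dif_pos rfl

theorem cellPerm_ne_one (σ : Equiv.Perm (Fin N)) {x : unitInterval} (hx : x ≠ 1) :
    cellPerm σ x ≠ 1 := by
  intro h
  have := congrArg Subtype.val h
  rw [coe_cellPerm σ hx] at this
  exact (shift_mem σ hx).2.ne this

theorem cell_cellPerm (σ : Equiv.Perm (Fin N)) {x : unitInterval} (hx : x ≠ 1) :
    cell N (cellPerm σ x) = σ (cell N x) := by
  have hN : (0 : ℝ) < N := Nat.cast_pos.2 (NeZero.pos N)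
  have h1 := cell_le (N := N) hx
  have h2 := lt_cell_add_one (N := N) hx
  have e : (N : ℝ) * (cellPerm σ x) = N * x - cell N x + σ (cell N x) := by
    rw [coe_cellPerm σ hx]; field_simp; ring
  refine cell_eq_of_mem (cellPerm_ne_one σ hx) ?_ ?_ <;> rw [e] <;> linarith

theorem cellPerm_inv_cellPerm (σ : Equiv.Perm (Fin N)) (x : unitInterval) :
    cellPerm σ⁻¹ (cellPerm σ x) = x := by
  by_cases hx : x = 1
  · rw [hx, cellPerm_one, cellPerm_one]
  · apply Subtype.ext
    rw [coe_cellPerm _ (cellPerm_ne_one σ hx), cell_cellPerm σ hx, coe_cellPerm σ hx,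
      show σ⁻¹ (σ (cell N x)) = cell N x from σ.symm_apply_apply _]
    ring

theorem measurable_cellPerm (σ : Equiv.Perm (Fin N)) : Measurable (cellPerm σ) := by
  have hf : Measurable fun i : Fin N => ((σ i : ℝ) - (i : ℝ)) / N := measurable_of_finite _
  have h : Measurable fun x : {x : unitInterval // ¬x = 1} =>
      (⟨((x : unitInterval) : ℝ) + ((σ (cell N x) : ℝ) - cell N x) / N,
        (shift_mem σ x.2).1, (shift_mem σ x.2).2.le⟩ : unitInterval) :=
    Measurable.subtype_mk ((measurable_subtype_coe.comp measurable_subtype_coe).add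
      (hf.comp (measurable_cell.comp measurable_subtype_coe)))
  exact Measurable.dite (s := {x : unitInterval | x = 1}) measurable_const h
    (measurableSet_singleton _)

/-- The interval exchange `cellPerm σ` as a measurable equivalence. -/
def cellEquiv (σ : Equiv.Perm (Fin N)) : unitInterval ≃ᵐ unitInterval where
  toFun := cellPerm σ
  invFun := cellPerm σ⁻¹
  left_inv := cellPerm_inv_cellPerm σ
  right_inv x := by simpa using cellPerm_inv_cellPerm σ⁻¹ x
  measurable_toFun := measurable_cellPerm σ
  measurable_invFun := measurable_cellPerm σ⁻¹

theorem volume_eq_sum_cell (A : Set unitInterval) :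
    volume A = ∑ i : Fin N, volume (A ∩ cell N ⁻¹' {i}) := by
  have h := sum_measure_preimage_singleton (μ := volume.restrict A) (f := cell N) Finset.univ
    fun i _ => measurable_cell (measurableSet_singleton i)
  simpa only [Measure.restrict_apply (measurable_cell (measurableSet_singleton _)),
    Finset.coe_univ, Set.preimage_univ, Measure.restrict_apply_univ, Set.inter_comm] using h.symm

theorem volume_preimage_cellPerm_inter (σ : Equiv.Perm (Fin N)) (A : Set unitInterval) (i : Fin N) :
    volume (cellPerm σ ⁻¹' A ∩ cell N ⁻¹' {i}) = volume (A ∩ cell N ⁻¹' {σ i}) := by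
  rw [← measure_sdiff_null (s := cellPerm σ ⁻¹' A ∩ cell N ⁻¹' {i}) (measure_singleton 1),
    ← measure_sdiff_null (s := A ∩ cell N ⁻¹' {σ i}) (measure_singleton 1),
    unitInterval.volume_apply, unitInterval.volume_apply,
    ← measure_preimage_add_right volume (((σ i : ℝ) - i) / N)
      (Subtype.val '' ((A ∩ cell N ⁻¹' {σ i}) \ {1}))]
  congr 1
  ext t
  constructor
  · rintro ⟨x, ⟨⟨hxA, rfl⟩, hx⟩, rfl⟩
    exact ⟨cellPerm σ x, ⟨⟨hxA, cell_cellPerm σ hx⟩, cellPerm_ne_one σ hx⟩, coe_cellPerm σ hx⟩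
  · rintro ⟨y, ⟨⟨hyA, hyc⟩, hy⟩, hyt⟩
    have hc : cell N (cellPerm σ⁻¹ y) = i := by
      rw [cell_cellPerm σ⁻¹ hy, show cell N y = σ i from hyc]
      simp
    have hinv : cellPerm σ (cellPerm σ⁻¹ y) = y := by
      simpa only [inv_inv] using cellPerm_inv_cellPerm σ⁻¹ y
    refine ⟨cellPerm σ⁻¹ y, ⟨⟨?_, hc⟩, cellPerm_ne_one _ hy⟩, ?_⟩
    · rwa [Set.mem_preimage, hinv]
    · have hcoe := coe_cellPerm σ (cellPerm_ne_one σ⁻¹ hy)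
      rw [hinv, hc] at hcoe
      linarith

theorem measurePreserving_cellEquiv (σ : Equiv.Perm (Fin N)) :
    MeasurePreserving (cellEquiv σ) volume volume := by
  refine ⟨(cellEquiv σ).measurable, Measure.ext fun A hA => ?_⟩
  rw [Measure.map_apply (cellEquiv σ).measurable hA, volume_eq_sum_cell (N := N) A,
    volume_eq_sum_cell (N := N) (cellEquiv σ ⁻¹' A)]
  exact Fintype.sum_equiv σ _ _ fun i => volume_preimage_cellPerm_inter σ A i

theorem ae_ne_one : ∀ᵐ x : unitInterval, x ≠ 1 := by
  simp [ae_iff]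

theorem ae_fst_and_snd {α : Type*} [MeasurableSpace α] {μ : Measure α} {p : α → Prop}
    (hp : ∀ᵐ x ∂μ, p x) : ∀ᵐ z ∂μ.prod μ, p z.1 ∧ p z.2 :=
  (Measure.quasiMeasurePreserving_fst.ae hp).and (Measure.quasiMeasurePreserving_snd.ae hp)

theorem ae_cell_cellEquiv (σ : Equiv.Perm (Fin N)) :
    ∀ᵐ x : unitInterval, cell N (cellEquiv σ x) = σ (cell N x) := by
  filter_upwards [ae_ne_one] with x hx using cell_cellPerm σ hx

theorem volume_cell (i : Fin N) : volume.real (cell N ⁻¹' {i}) = 1 / N := by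
  have hconst : ∀ j, volume.real (cell N ⁻¹' {j}) = volume.real (cell N ⁻¹' {i}) := fun j => by
    have h := volume_preimage_cellPerm_inter (Equiv.swap j i) Set.univ j
    rw [Set.preimage_univ, Equiv.swap_apply_left, Set.univ_inter, Set.univ_inter] at h
    rw [measureReal_def, h, measureReal_def]
  have hsum : ∑ j, volume.real (cell N ⁻¹' {j}) = 1 := by
    have h := congrArg ENNReal.toReal (volume_eq_sum_cell (N := N) Set.univ)
    rw [ENNReal.toReal_sum fun _ _ => measure_ne_top _ _] at h
    simpa [measureReal_def] using h.symm
  simp only [hconst, Finset.sum_const, Finset.card_univ, Fintype.card_fin, nsmul_eq_mul] at hsum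
  rw [eq_div_iff (NeZero.ne _), mul_comm, hsum]

end Cells

section BoundedKernels

/-- A strongly measurable kernel on the unit square whose norm is almost everywhere at most `M`. -/
structure IsBoundedKernel {E : Type*} [NormedAddCommGroup E] (u : unitInterval × unitInterval → E)
    (M : ℝ) : Prop where
  aestronglyMeasurable : AEStronglyMeasurable u volume
  ae_norm_le : ∀ᵐ z, ‖u z‖ ≤ M

namespace IsBoundedKernel

variable {E : Type*} [NormedAddCommGroup E] {u : unitInterval × unitInterval → E} {M : ℝ}

theorem integrable (hu : IsBoundedKernel u M) : Integrable u :=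
  Integrable.of_bound hu.aestronglyMeasurable M hu.ae_norm_le

theorem nonneg (hu : IsBoundedKernel u M) : 0 ≤ M :=
  let ⟨_, hz⟩ := hu.ae_norm_le.exists
  (norm_nonneg _).trans hz

theorem ae_abs_le {u : unitInterval × unitInterval → ℝ} (hu : IsBoundedKernel u M) :
    ∀ᵐ z, |u z| ≤ M :=
  hu.ae_norm_le

end IsBoundedKernel

/-- The cut norm of the kernel `u` is at most `ε`. -/
def KernelCutLE (u : unitInterval × unitInterval → ℝ) (ε : ℝ) : Prop :=
  ∀ ⦃S T : Set unitInterval⦄, MeasurableSet S → MeasurableSet T → |∫ z in S ×ˢ T, u z| ≤ ε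

variable {u u' : unitInterval × unitInterval → ℝ} {ε η : ℝ}

theorem abs_setIntegral_sub_setIntegral_le {α : Type*} [MeasurableSpace α] {μ : Measure α}
    {f g : α → ℝ} (hf : Integrable f μ) (hg : Integrable g μ) (S : Set α) :
    |(∫ z in S, f z ∂μ) - ∫ z in S, g z ∂μ| ≤ ∫ z, |f z - g z| ∂μ := by
  rw [← integral_sub hf.integrableOn hg.integrableOn]
  exact abs_integral_le_integral_abs.trans
    (setIntegral_le_integral (hf.sub hg).abs (ae_of_all _ fun _ => abs_nonneg _))

theorem KernelCutLE.sub_of_integral_abs_sub_le {v v' : unitInterval × unitInterval → ℝ} {η' : ℝ}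
    (h : KernelCutLE (fun z => u z - u' z) ε) (hu : Integrable u) (hu' : Integrable u')
    (hv : Integrable v) (hv' : Integrable v') (hη : ∫ z, |u z - v z| ≤ η)
    (hη' : ∫ z, |u' z - v' z| ≤ η') : KernelCutLE (fun z => v z - v' z) (ε + η + η') := by
  intro S T hS hT
  have hcut := h hS hT
  have huv := (abs_setIntegral_sub_setIntegral_le hu hv (S ×ˢ T)).trans hη
  have huv' := (abs_setIntegral_sub_setIntegral_le hu' hv' (S ×ˢ T)).trans hη'
  rw [integral_sub hu.integrableOn hu'.integrableOn] at hcut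
  rw [integral_sub hv.integrableOn hv'.integrableOn]
  rw [abs_le] at hcut huv huv' ⊢
  constructor <;> linarith

end BoundedKernels

section StepKernels

variable {N : ℕ} [NeZero N]

/-- The step kernel on the unit square with values `D` on the cells of the equipartition. -/
def stepKernel (D : Fin N → Fin N → ℝ) (z : unitInterval × unitInterval) : ℝ :=
  D (cell N z.1) (cell N z.2)

variable {D : Fin N → Fin N → ℝ} {M ε : ℝ}

theorem measurable_stepKernel (D : Fin N → Fin N → ℝ) : Measurable (stepKernel D) :=
  (measurable_of_finite fun p : Fin N × Fin N => D p.1 p.2).comp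
    ((measurable_cell.comp measurable_fst).prodMk (measurable_cell.comp measurable_snd))

theorem isBoundedKernel_stepKernel (hD : ∀ i j, |D i j| ≤ M) : IsBoundedKernel (stepKernel D) M :=
  ⟨(measurable_stepKernel D).aestronglyMeasurable, ae_of_all _ fun _ => hD _ _⟩

theorem integrable_stepKernel (D : Fin N → Fin N → ℝ) : Integrable (stepKernel D) := by
  obtain ⟨M, hM⟩ := (Set.finite_range fun p : Fin N × Fin N => |D p.1 p.2|).bddAbove
  exact (isBoundedKernel_stepKernel fun i j => hM ⟨(i, j), rfl⟩).integrable

theorem setIntegral_stepKernel (D : Fin N → Fin N → ℝ) (S T : Set unitInterval) :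
    ∫ z in S ×ˢ T, stepKernel D z =
      ∑ i, ∑ j, volume.real (S ∩ cell N ⁻¹' {i}) * volume.real (T ∩ cell N ⁻¹' {j}) * D i j := by
  have hcell (A : Set unitInterval) (i : Fin N) :
      ((volume.restrict A).map (cell N)).real {i} = volume.real (A ∩ cell N ⁻¹' {i}) := by
    rw [map_measureReal_apply measurable_cell (measurableSet_singleton i),
      measureReal_restrict_apply (measurable_cell (measurableSet_singleton i)), Set.inter_comm]
  calc ∫ z in S ×ˢ T, stepKernel D z
      = ∫ p, D p.1 p.2
          ∂((volume.restrict S).map (cell N)).prod ((volume.restrict T).map (cell N)) := by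
        rw [Measure.map_prod_map _ _ measurable_cell measurable_cell, Measure.prod_restrict,
          integral_map (measurable_cell.prodMap measurable_cell).aemeasurable
            (measurable_of_finite _).aestronglyMeasurable]
        rfl
    _ = _ := by
        rw [integral_fintype .of_finite, Fintype.sum_prod_type]
        simp only [← Set.singleton_prod_singleton, measureReal_prod_prod, hcell, smul_eq_mul]

theorem CutLE.kernelCutLE_stepKernel (h : CutLE D ε) : KernelCutLE (stepKernel D) (4 * ε) := by
  intro S T _ _
  have hN : (N : ℝ) ≠ 0 := NeZero.ne _
  have hle (A : Set unitInterval) (i : Fin N) :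
      |volume.real (A ∩ cell N ⁻¹' {i})| ≤ 1 / N := by
    rw [abs_of_nonneg measureReal_nonneg, ← volume_cell i]
    exact measureReal_mono Set.inter_subset_right
  have hN' : (0 : ℝ) ≤ 1 / N := by positivity
  have hsum := h.abs_sum_mul_mul_le hN' hN' (hle S) (hle T)
  rw [← setIntegral_stepKernel, Fintype.card_fin] at hsum
  refine hsum.trans_eq ?_
  field_simp

theorem KernelCutLE.cutLE (h : KernelCutLE (stepKernel D) ε) : CutLE D ε := by
  intro S T
  have hN : (0 : ℝ) < N := Nat.cast_pos.2 (NeZero.pos N)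
  have hcell (A : Finset (Fin N)) (i : Fin N) :
      volume.real (cell N ⁻¹' A ∩ cell N ⁻¹' {i}) = if i ∈ A then 1 / (N : ℝ) else 0 := by
    split_ifs with hi
    · rw [Set.inter_eq_self_of_subset_right (Set.preimage_mono (by simpa using hi)), volume_cell]
    · rw [← Set.preimage_inter, Set.inter_singleton_eq_empty.2 (by simpa using hi),
        Set.preimage_empty, measureReal_empty]
  have hint := h (measurable_cell S.measurableSet) (measurable_cell T.measurableSet)
  have hsum : ∑ i, ∑ j, (if i ∈ S then 1 / (N : ℝ) else 0) * (if j ∈ T then 1 / (N : ℝ) else 0) *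
      D i j = (∑ i ∈ S, ∑ j ∈ T, D i j) / (N : ℝ) ^ 2 := by
    simp only [ite_mul, mul_ite, zero_mul, mul_zero, Finset.sum_ite_mem, Finset.univ_inter,
      Finset.sum_ite_irrel, Finset.sum_const_zero, Finset.sum_div]
    refine Finset.sum_congr rfl fun i _ => Finset.sum_congr rfl fun j _ => ?_
    field_simp
  simp only [setIntegral_stepKernel, hcell] at hint
  rw [hsum, abs_div, abs_of_pos (by positivity : (0 : ℝ) < (N : ℝ) ^ 2),
    div_le_iff₀ (by positivity)] at hint
  rwa [Fintype.card_fin]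

end StepKernels

section StepApproximation

/-- The left endpoint of the cell `i`. -/
def cellPoint {N : ℕ} (i : Fin N) : unitInterval :=
  ⟨i / N, unitInterval.div_mem i.1.cast_nonneg N.cast_nonneg (by exact_mod_cast i.2.le)⟩

theorem dist_cellPoint_cell_le {N : ℕ} [NeZero N] {x : unitInterval} (hx : x ≠ 1) :
    dist x (cellPoint (cell N x)) ≤ 1 / N := by
  have hN : (0 : ℝ) < N := Nat.cast_pos.2 (NeZero.pos N)
  have h1 := cell_le (N := N) hx
  have h2 := lt_cell_add_one (N := N) hx
  have e : (x : ℝ) - (cell N x : ℕ) / N = (N * x - cell N x) / N := by field_simp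
  rw [Subtype.dist_eq, Real.dist_eq, cellPoint, e, abs_of_nonneg (by bound)]
  gcongr
  linarith

variable {u : unitInterval × unitInterval → ℝ} {M η : ℝ}

theorem eventually_exists_stepKernel_of_continuous (hu : Continuous u) (hη : 0 < η) :
    ∀ᶠ N : ℕ in atTop, ∀ [NeZero N], ∃ D : Fin N → Fin N → ℝ,
      ∫ z, |u z - stepKernel D z| ≤ η := by
  obtain ⟨δ, hδ, hosc⟩ := Metric.uniformContinuous_iff.1
    (CompactSpace.uniformContinuous_of_continuous hu) η hη
  filter_upwards [(tendsto_one_div_atTop_nhds_zero_nat (𝕜 := ℝ)).eventually_lt_const hδ]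
    with N hN _
  refine ⟨fun i j => u (cellPoint i, cellPoint j), ?_⟩
  have hle : ∀ᵐ z, |u z - stepKernel (fun i j : Fin N => u (cellPoint i, cellPoint j)) z| ≤ η := by
    filter_upwards [ae_fst_and_snd ae_ne_one] with z hz
    exact (hosc (max_lt ((dist_cellPoint_cell_le hz.1).trans_lt hN)
      ((dist_cellPoint_cell_le hz.2).trans_lt hN))).le
  have hui : Integrable u := hu.integrable_of_hasCompactSupport
    (HasCompactSupport.of_compactSpace u)
  simpa using integral_mono_ae (hui.sub (integrable_stepKernel _)).abs (integrable_const η) hle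

theorem eventually_exists_stepKernel_of_integrable (hu : Integrable u) (hη : 0 < η) :
    ∀ᶠ N : ℕ in atTop, ∀ [NeZero N], ∃ D : Fin N → Fin N → ℝ,
      ∫ z, |u z - stepKernel D z| ≤ η := by
  obtain ⟨g, hg, hgi⟩ := hu.exists_boundedContinuous_integral_sub_le (half_pos hη)
  filter_upwards [eventually_exists_stepKernel_of_continuous g.continuous (half_pos hη)]
    with N hN _
  obtain ⟨D, hD⟩ := hN
  refine ⟨D, ?_⟩
  have hug := (hu.sub hgi).abs
  have hgD := (hgi.sub (integrable_stepKernel D)).abs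
  calc ∫ z, |u z - stepKernel D z|
      ≤ ∫ z, (|u z - g z| + |g z - stepKernel D z|) :=
        integral_mono (hu.sub (integrable_stepKernel D)).abs (hug.add hgD)
          fun z => abs_sub_le _ _ _
    _ = (∫ z, |u z - g z|) + ∫ z, |g z - stepKernel D z| := integral_add hug hgD
    _ ≤ η / 2 + η / 2 := add_le_add hg hD
    _ = η := add_halves η

theorem IsBoundedKernel.eventually_exists_stepKernel (hu : IsBoundedKernel u M) (hη : 0 < η) :
    ∀ᶠ N : ℕ in atTop, ∀ [NeZero N], ∃ D : Fin N → Fin N → ℝ,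
      (∀ i j, |D i j| ≤ M) ∧ ∫ z, |u z - stepKernel D z| ≤ η := by
  have hM : -M ≤ M := neg_le_self hu.nonneg
  filter_upwards [eventually_exists_stepKernel_of_integrable hu.integrable hη] with N hN _
  obtain ⟨D, hD⟩ := hN
  -- Truncating the values to `[-M, M]` only brings the step kernel closer to `u`.
  let D' : Fin N → Fin N → ℝ := fun i j => Set.projIcc (-M) M hM (D i j)
  refine ⟨D', fun i j => abs_le.2 (Set.projIcc (-M) M hM (D i j)).2, le_trans ?_ hD⟩
  refine integral_mono_ae (hu.integrable.sub (integrable_stepKernel D')).abs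
    (hu.integrable.sub (integrable_stepKernel D)).abs ?_
  filter_upwards [hu.ae_abs_le] with z hz
  calc |u z - stepKernel D' z|
      = |(Set.projIcc (-M) M hM (u z) : ℝ) - Set.projIcc (-M) M hM (stepKernel D z)| := by
        rw [Set.projIcc_of_mem hM (abs_le.1 hz)]; rfl
    _ ≤ |u z - stepKernel D z| := Set.abs_projIcc_sub_projIcc hM

end StepApproximation

section KernelMoment

variable {V : Type*} [Fintype V]

theorem measurePreserving_eval_pair {α : Type*} [MeasurableSpace α] (μ : Measure α)
    [IsProbabilityMeasure μ] {i j : V} (hij : i ≠ j) :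
    MeasurePreserving (fun ξ : V → α => (ξ i, ξ j)) (Measure.pi fun _ => μ) (μ.prod μ) := by
  have hindep := (ProbabilityTheory.iIndepFun_pi (μ := fun _ : V => μ) (X := fun _ x => x)
    fun _ => aemeasurable_id).indepFun hij
  refine ⟨(measurable_pi_apply i).prodMk (measurable_pi_apply j), ?_⟩
  rw [(ProbabilityTheory.indepFun_iff_map_prod_eq_prod_map_map
    (measurable_pi_apply i).aemeasurable (measurable_pi_apply j).aemeasurable).1 hindep]
  congr 1 <;> exact (measurePreserving_eval (fun _ : V => μ) _).map_eq

variable (F : OrientedSimpleGraph V)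

theorem measurePreserving_edge (e : F.edges) :
    MeasurePreserving (fun ξ : V → unitInterval => (ξ e.1.1, ξ e.1.2)) volume volume :=
  measurePreserving_eval_pair volume fun h : e.1.1 = e.1.2 => by
    have he : (e.1.1, e.1.2) ∈ F.edges := e.2
    rw [h] at he
    exact F.oriented _ _ he he

theorem ae_forall_edge {p : F.edges → unitInterval × unitInterval → Prop}
    (hp : ∀ e, ∀ᵐ z, p e z) :
    ∀ᵐ ξ : V → unitInterval, ∀ e : F.edges, p e (ξ e.1.1, ξ e.1.2) :=
  eventually_all.2 fun e => (measurePreserving_edge F e).quasiMeasurePreserving.ae (hp e)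

/-- The density of the oriented graph `F`, the edge `e` carrying the scalar kernel `u e`. -/
def kernelMoment (u : F.edges → unitInterval × unitInterval → ℝ) : ℝ :=
  ∫ ξ : V → unitInterval, ∏ e : F.edges, u e (ξ e.1.1, ξ e.1.2)

theorem abs_prod_sub_prod_le {ι : Type*} (s : Finset ι) (f g : ι → ℝ) {M : ℝ} (hM : 1 ≤ M)
    (hf : ∀ e ∈ s, |f e| ≤ M) (hg : ∀ e ∈ s, |g e| ≤ M) :
    |∏ e ∈ s, f e - ∏ e ∈ s, g e| ≤ M ^ s.card * ∑ e ∈ s, |f e - g e| := by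
  induction s using Finset.cons_induction_on with
  | empty => simp
  | cons a s ha ih =>
    rw [Finset.forall_mem_cons] at hf hg
    have hprod : |∏ e ∈ s, g e| ≤ M ^ (s.card + 1) := abs_prod_le_pow s hM hg.2 (Nat.le_succ _)
    rw [Finset.prod_cons, Finset.prod_cons, Finset.sum_cons, Finset.card_cons]
    calc |f a * ∏ e ∈ s, f e - g a * ∏ e ∈ s, g e|
        = |f a * (∏ e ∈ s, f e - ∏ e ∈ s, g e) + (f a - g a) * ∏ e ∈ s, g e| := by
          congr 1; ring
      _ ≤ |f a| * |∏ e ∈ s, f e - ∏ e ∈ s, g e| + |f a - g a| * |∏ e ∈ s, g e| := by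
          rw [← abs_mul, ← abs_mul]; exact abs_add_le _ _
      _ ≤ M * (M ^ s.card * ∑ e ∈ s, |f e - g e|) + |f a - g a| * M ^ (s.card + 1) := by
          gcongr
          exacts [hf.1, ih hf.2 hg.2]
      _ = M ^ (s.card + 1) * (|f a - g a| + ∑ e ∈ s, |f e - g e|) := by ring

variable {F} {u u' : F.edges → unitInterval × unitInterval → ℝ} {M : ℝ}

theorem integrable_prod_edge (hM : 1 ≤ M) (hu : ∀ e, IsBoundedKernel (u e) M) :
    Integrable (fun ξ : V → unitInterval => ∏ e : F.edges, u e (ξ e.1.1, ξ e.1.2)) := by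
  refine Integrable.of_bound (Finset.aestronglyMeasurable_fun_prod _ fun e _ =>
    (hu e).aestronglyMeasurable.comp_measurePreserving (measurePreserving_edge F e))
    (M ^ F.edges.card) ?_
  filter_upwards [ae_forall_edge F fun e => (hu e).ae_abs_le] with ξ hξ
  exact abs_prod_le_pow _ hM (fun e _ => hξ e) (by simp)

theorem abs_kernelMoment_sub_le (hM : 1 ≤ M) (hu : ∀ e, IsBoundedKernel (u e) M)
    (hu' : ∀ e, IsBoundedKernel (u' e) M) :
    |kernelMoment F u - kernelMoment F u'| ≤
      M ^ F.edges.card * ∑ e, ∫ z, |u e z - u' e z| := by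
  have hi := integrable_prod_edge hM hu
  have hi' := integrable_prod_edge hM hu'
  have hd (e : F.edges) : Integrable fun z => |u e z - u' e z| :=
    ((hu e).integrable.sub (hu' e).integrable).abs
  have hd' (e : F.edges) : Integrable fun ξ : V → unitInterval =>
      |u e (ξ e.1.1, ξ e.1.2) - u' e (ξ e.1.1, ξ e.1.2)| :=
    (measurePreserving_edge F e).integrable_comp_of_integrable (hd e)
  have hle : ∀ᵐ ξ : V → unitInterval,
      |∏ e : F.edges, u e (ξ e.1.1, ξ e.1.2) - ∏ e : F.edges, u' e (ξ e.1.1, ξ e.1.2)| ≤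
        M ^ F.edges.card *
          ∑ e : F.edges, |u e (ξ e.1.1, ξ e.1.2) - u' e (ξ e.1.1, ξ e.1.2)| := by
    filter_upwards [ae_forall_edge F fun e => (hu e).ae_abs_le,
      ae_forall_edge F fun e => (hu' e).ae_abs_le] with ξ h h'
    simpa using abs_prod_sub_prod_le Finset.univ (fun e : F.edges => u e (ξ e.1.1, ξ e.1.2))
      (fun e => u' e (ξ e.1.1, ξ e.1.2)) hM (fun e _ => h e) fun e _ => h' e
  rw [kernelMoment, kernelMoment, ← integral_sub hi hi']
  refine abs_integral_le_integral_abs.trans <| (integral_mono_ae (hi.sub hi').abs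
    ((integrable_finsetSum _ fun e _ => hd' e).const_mul _) hle).trans_eq ?_
  rw [integral_const_mul, integral_finsetSum _ fun e _ => hd' e]
  congr 1
  refine Finset.sum_congr rfl fun e _ => ?_
  have hmp := measurePreserving_edge F e
  rw [← hmp.map_eq, integral_map hmp.measurable.aemeasurable]
  rw [hmp.map_eq]
  exact (hd e).aestronglyMeasurable

theorem kernelMoment_stepKernel [DecidableEq V] {N : ℕ} [NeZero N]
    (D : V × V → Fin N → Fin N → ℝ) :
    kernelMoment F (fun e => stepKernel (D e)) = moment F D := by
  let ν : Measure (Fin N) := volume.map (cell N)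
  have : IsProbabilityMeasure ν := Measure.isProbabilityMeasure_map measurable_cell.aemeasurable
  have hν (i : Fin N) : ν.real {i} = 1 / N := by
    rw [map_measureReal_apply measurable_cell (measurableSet_singleton i), volume_cell]
  have hmp : MeasurePreserving (fun (ξ : V → unitInterval) i => cell N (ξ i)) volume
      (Measure.pi fun _ => ν) :=
    measurePreserving_pi (fun _ : V => (volume : Measure unitInterval)) (fun _ => ν)
      fun _ => ⟨measurable_cell, rfl⟩
  calc kernelMoment F (fun e => stepKernel (D e))
      = ∫ x, ∏ e ∈ F.edges, D e (x e.1) (x e.2) ∂(Measure.pi fun _ : V => ν) := by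
        rw [← hmp.map_eq, integral_map hmp.measurable.aemeasurable
          (measurable_of_finite _).aestronglyMeasurable, kernelMoment]
        congr! 2 with ξ
        exact Finset.prod_coe_sort F.edges fun e => D e (cell N (ξ e.1)) (cell N (ξ e.2))
    _ = ∑ x : V → Fin N, (1 / (N : ℝ)) ^ Fintype.card V •
          ∏ e ∈ F.edges, D e (x e.1) (x e.2) := by
        rw [integral_fintype .of_finite]
        simp only [measureReal_def, Measure.pi_singleton, ENNReal.toReal_prod]
        simp only [← measureReal_def, hν, Finset.prod_const, Finset.card_univ]
    _ = moment F D := by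
        rw [moment, Fintype.expect_eq_sum_div_card, Finset.sum_div, Fintype.card_fun,
          Fintype.card_fin]
        refine Finset.sum_congr rfl fun x _ => ?_
        push_cast
        rw [one_div, inv_pow, smul_eq_mul, inv_mul_eq_div]

end KernelMoment

section ScalarCounting

variable {M ε η : ℝ}

theorem eventually_exists_stepKernel_family {C : Type*} [Finite C]
    {u : C → unitInterval × unitInterval → ℝ} (hu : ∀ c, IsBoundedKernel (u c) M) (hη : 0 < η) :
    ∀ᶠ N : ℕ in atTop, ∀ [NeZero N], ∃ D : C → Fin N → Fin N → ℝ,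
      ∀ c, (∀ i j, |D c i j| ≤ M) ∧ ∫ z, |u c z - stepKernel (D c) z| ≤ η := by
  filter_upwards [eventually_all.2 fun c => (hu c).eventually_exists_stepKernel hη] with N hN _
  choose D hD using fun c => hN c
  exact ⟨D, hD⟩

variable {V : Type*} {F : OrientedSimpleGraph V}
  {u u' : F.edges → unitInterval × unitInterval → ℝ}

theorem eventually_exists_stepKernel_edges (hu : ∀ e, IsBoundedKernel (u e) M) (hη : 0 < η) :
    ∀ᶠ N : ℕ in atTop, ∀ [NeZero N], ∃ D : V × V → Fin N → Fin N → ℝ,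
      ∀ e : F.edges, (∀ i j, |D e i j| ≤ M) ∧ ∫ z, |u e z - stepKernel (D e) z| ≤ η := by
  filter_upwards [eventually_exists_stepKernel_family hu hη] with N hN _
  obtain ⟨D, hD⟩ := hN
  refine ⟨Function.extend Subtype.val D 0, fun e => ?_⟩
  rw [Subtype.val_injective.extend_apply]
  exact hD e

variable [Fintype V]

theorem abs_kernelMoment_sub_moment_le [DecidableEq V] {N : ℕ} [NeZero N]
    {D : V × V → Fin N → Fin N → ℝ} (hM : 1 ≤ M) (hu : ∀ e, IsBoundedKernel (u e) M)
    (hD : ∀ e : F.edges, (∀ i j, |D e i j| ≤ M) ∧ ∫ z, |u e z - stepKernel (D e) z| ≤ η) :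
    |kernelMoment F u - moment F D| ≤ M ^ F.edges.card * (F.edges.card * η) := by
  rw [← kernelMoment_stepKernel]
  refine (abs_kernelMoment_sub_le hM hu fun e => isBoundedKernel_stepKernel (hD e).1).trans ?_
  gcongr
  calc ∑ e : F.edges, ∫ z, |u e z - stepKernel (D e) z| ≤ ∑ _e : F.edges, η :=
        Finset.sum_le_sum fun e _ => (hD e).2
    _ = F.edges.card * η := by simp

theorem abs_kernelMoment_sub_le_add (hM : 1 ≤ M) (hε : 0 ≤ ε) (hη : 0 < η)
    (hu : ∀ e, IsBoundedKernel (u e) M) (hu' : ∀ e, IsBoundedKernel (u' e) M)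
    (hcut : ∀ e, KernelCutLE (fun z => u e z - u' e z) ε) :
    |kernelMoment F u - kernelMoment F u'| ≤ M ^ F.edges.card * (F.edges.card * η) +
      F.edges.card * (4 * M ^ F.edges.card * M ^ F.edges.card * (ε + η + η)) +
      M ^ F.edges.card * (F.edges.card * η) := by
  classical
  obtain ⟨N, ⟨hN, hN'⟩, hpos⟩ := (((eventually_exists_stepKernel_edges hu hη).and
    (eventually_exists_stepKernel_edges hu' hη)).and (eventually_gt_atTop 0)).exists
  have : NeZero N := ⟨hpos.ne'⟩
  obtain ⟨D, hD⟩ := hN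
  obtain ⟨D', hD'⟩ := hN'
  have hcutD : ∀ e ∈ F.edges, CutLE (fun x y => D e x y - D' e x y) (ε + η + η) := fun e he =>
    KernelCutLE.cutLE (D := fun x y => D e x y - D' e x y) <|
      (hcut ⟨e, he⟩).sub_of_integral_abs_sub_le (hu _).integrable (hu' _).integrable
        (integrable_stepKernel (D e)) (integrable_stepKernel (D' e)) (hD ⟨e, he⟩).2
        (hD' ⟨e, he⟩).2
  have hmom := abs_moment_sub_le F (by positivity) hM (fun e he => (hD ⟨e, he⟩).1)
    (fun e he => (hD' ⟨e, he⟩).1) hcutD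
  have happrox := abs_kernelMoment_sub_moment_le hM hu hD
  have happrox' := abs_kernelMoment_sub_moment_le hM hu' hD'
  grind

theorem abs_kernelMoment_sub_le_of_kernelCutLE (hM : 1 ≤ M) (hε : 0 ≤ ε)
    (hu : ∀ e, IsBoundedKernel (u e) M) (hu' : ∀ e, IsBoundedKernel (u' e) M)
    (hcut : ∀ e, KernelCutLE (fun z => u e z - u' e z) ε) :
    |kernelMoment F u - kernelMoment F u'| ≤
      F.edges.card * (4 * M ^ F.edges.card * M ^ F.edges.card * ε) := by
  let n : ℝ := F.edges.card
  let P : ℝ := M ^ F.edges.card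
  have hlim : Tendsto (fun η : ℝ => P * (n * η) + n * (4 * P * P * (ε + η + η)) + P * (n * η))
      (𝓝[>] 0) (𝓝 (n * (4 * P * P * ε))) :=
    (Continuous.tendsto' (by fun_prop) _ _ (by ring)).mono_left nhdsWithin_le_nhds
  exact ge_of_tendsto hlim <| eventually_mem_nhdsWithin.mono fun η hη =>
    abs_kernelMoment_sub_le_add hM hε hη hu hu' hcut

end ScalarCounting

section ScalarInverseCounting

theorem isEquidistributed_finProdFinEquiv_symm_fst (k r : ℕ) [NeZero r] :
    IsEquidistributed fun y : Fin (k * r) => (finProdFinEquiv.symm y).1 := by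
  intro h
  rw [Fintype.expect_equiv finProdFinEquiv.symm _ (fun p : Fin k × Fin r => h p.1) fun _ => rfl,
    ← Finset.univ_product_univ, Finset.expect_product]
  simp only [Fintype.expect_const]

theorem CutLE.kernelCutLE_sub_comp_cellEquiv {N : ℕ} [NeZero N] {σ : Equiv.Perm (Fin N)}
    {D D' : Fin N → Fin N → ℝ} {ε η η' : ℝ} {u u' : unitInterval × unitInterval → ℝ}
    (h : CutLE (fun x y => D x y - D' (σ x) (σ y)) ε) (hu : Integrable u) (hu' : Integrable u')
    (hη : ∫ z, |u z - stepKernel D z| ≤ η) (hη' : ∫ z, |u' z - stepKernel D' z| ≤ η') :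
    KernelCutLE (fun z => u z - u' (cellEquiv σ z.1, cellEquiv σ z.2)) (4 * ε + η + η') := by
  have hφ := (measurePreserving_cellEquiv σ).prod (measurePreserving_cellEquiv σ)
  have hcut : KernelCutLE
      (fun z => stepKernel D z - stepKernel (fun x y => D' (σ x) (σ y)) z) (4 * ε) :=
    h.kernelCutLE_stepKernel
  have hstep : ∫ z : unitInterval × unitInterval,
      |stepKernel (fun x y => D' (σ x) (σ y)) z - u' (cellEquiv σ z.1, cellEquiv σ z.2)| ≤ η' := by
    refine le_of_eq_of_le ?_ hη'
    refine Eq.trans (integral_congr_ae ?_) <| hφ.integral_comp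
      ((cellEquiv σ).prodCongr (cellEquiv σ)).measurableEmbedding
      fun z => |u' z - stepKernel D' z|
    filter_upwards [ae_fst_and_snd (ae_cell_cellEquiv σ)] with z hz
    rw [abs_sub_comm]
    simp only [stepKernel, hz.1, hz.2, Prod.map]
  refine hcut.sub_of_integral_abs_sub_le (integrable_stepKernel D) (integrable_stepKernel _) hu
    (hφ.integrable_comp_of_integrable hu') ?_ hstep
  simpa only [abs_sub_comm] using hη

theorem pow_card_edges_mul_le {k : ℕ} (F : OrientedSimpleGraph (Fin k)) {M η t : ℝ} (hM : 1 ≤ M)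
    (hk : 0 < k) (hη : 0 ≤ η) (ht : t ≤ η / (M ^ (k * k) * (k * k))) :
    M ^ F.edges.card * (F.edges.card * t) ≤ η := by
  have hcard : F.edges.card ≤ k * k := by simpa using Finset.card_le_univ F.edges
  calc M ^ F.edges.card * (F.edges.card * t)
      ≤ M ^ F.edges.card * (F.edges.card * (η / (M ^ (k * k) * (k * k)))) := by gcongr
    _ ≤ M ^ (k * k) * ((k * k : ℕ) * (η / (M ^ (k * k) * (k * k)))) := by gcongr
    _ = η := by push_cast; field_simp

theorem exists_measurePreserving_kernelCutLE (C : Type*) [Finite C] {M ε : ℝ} (hM : 1 ≤ M)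
    (hε : 0 < ε) :
    ∃ k : ℕ, ∃ η, 0 < η ∧ ∀ {u u' : C → unitInterval × unitInterval → ℝ},
      (∀ c, IsBoundedKernel (u c) M) → (∀ c, IsBoundedKernel (u' c) M) →
      (∀ (F : OrientedSimpleGraph (Fin k)) (c : Fin k × Fin k → C),
        |kernelMoment F (fun e => u (c e)) - kernelMoment F (fun e => u' (c e))| ≤ η) →
      ∃ φ : unitInterval ≃ᵐ unitInterval, MeasurePreserving φ volume volume ∧
        ∀ c, KernelCutLE (fun z => u c z - u' c (φ z.1, φ z.2)) ε := by
  obtain ⟨k, hk, η, hη, hperm⟩ :=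
    exists_perm_cutLE_of_moment C (zero_lt_one.trans_le hM) (by positivity : 0 < ε / 8)
  refine ⟨k, η / 2, by positivity, fun {u u'} hu hu' hmom => ?_⟩
  let t : ℝ := min (ε / 4) (η / 4 / (M ^ (k * k) * (k * k)))
  have ht : 0 < t := by positivity
  have hmul : Tendsto (k * ·) atTop atTop :=
    tendsto_atTop_mono (fun r => Nat.le_mul_of_pos_left r hk) tendsto_id
  obtain ⟨r, ⟨hr, hr'⟩, hpos⟩ := ((hmul.eventually
    ((eventually_exists_stepKernel_family hu ht).and
      (eventually_exists_stepKernel_family hu' ht))).and (eventually_gt_atTop 0)).exists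
  have : NeZero r := ⟨hpos.ne'⟩
  have : NeZero (k * r) := ⟨(Nat.mul_pos hk hpos).ne'⟩
  obtain ⟨D, hD⟩ := hr
  obtain ⟨D', hD'⟩ := hr'
  have hle (F : OrientedSimpleGraph (Fin k)) :
      M ^ F.edges.card * (F.edges.card * t) ≤ η / 4 :=
    pow_card_edges_mul_le F hM hk (by positivity) (min_le_right _ _)
  obtain ⟨σ, hσ⟩ := hperm (isEquidistributed_finProdFinEquiv_symm_fst k r) (fun c => (hD c).1)
    (fun c => (hD' c).1) fun F c => by
      have happrox := (abs_kernelMoment_sub_moment_le (D := fun e => D (c e)) hM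
        (fun e : F.edges => hu (c e)) fun e => hD (c e)).trans (hle F)
      have happrox' := (abs_kernelMoment_sub_moment_le (D := fun e => D' (c e)) hM
        (fun e : F.edges => hu' (c e)) fun e => hD' (c e)).trans (hle F)
      have hmomF := hmom F c
      grind
  refine ⟨cellEquiv σ, measurePreserving_cellEquiv σ, fun c S T hS hT => ?_⟩
  have hcut := (hσ c).kernelCutLE_sub_comp_cellEquiv (hu c).integrable (hu' c).integrable
    (hD c).2 (hD' c).2 hS hT
  have htε : t ≤ ε / 4 := min_le_left _ _
  linarith

end ScalarInverseCounting

section ElementaryTensors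

variable {H : Type*} [NormedAddCommGroup H] [InnerProductSpace ℝ H] {S : Type*} [Fintype S]

theorem norm_hilbertTprod (v : S → H) : ‖hilbertTprod v‖ = ∏ i, ‖v i‖ := by
  refine (pow_left_inj₀ (norm_nonneg _) (by positivity) two_ne_zero).1 ?_
  simp only [← real_inner_self_eq_norm_sq, inner_hilbertTprod, ← Finset.prod_pow]

/-- The elementary tensor map `v ↦ ⨂ vᵢ` as a continuous multilinear map. -/
def hilbertTprodL (S H : Type*) [Fintype S] [NormedAddCommGroup H] [InnerProductSpace ℝ H] :
    ContinuousMultilinearMap ℝ (fun _ : S => H) (HilbertTensorPower S H) :=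
  MultilinearMap.mkContinuous
    ((UniformSpace.Completion.toComplL (𝕜 := ℝ)
      (E := AlgTensorPower S H)).toLinearMap.compMultilinearMap (AlgTensorPower.tprod S H))
    1 fun v => ((norm_hilbertTprod v).trans (one_mul _).symm).le

theorem hilbertTprodL_apply (v : S → H) : hilbertTprodL S H v = hilbertTprod v := rfl

theorem norm_hilbertTprodL_le : ‖hilbertTprodL S H‖ ≤ 1 :=
  MultilinearMap.mkContinuous_norm_le _ zero_le_one _

theorem norm_hilbertTprod_sub_le {v v' : S → H} {M ε : ℝ} (hM : 0 ≤ M) (hε : 0 ≤ ε)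
    (hv : ∀ i, ‖v i‖ ≤ M) (hv' : ∀ i, ‖v' i‖ ≤ M) (h : ∀ i, ‖v i - v' i‖ ≤ ε) :
    ‖hilbertTprod v - hilbertTprod v'‖ ≤ Fintype.card S * M ^ (Fintype.card S - 1) * ε := by
  rw [← hilbertTprodL_apply, ← hilbertTprodL_apply]
  calc _ ≤ ‖hilbertTprodL S H‖ * Fintype.card S * max ‖v‖ ‖v'‖ ^ (Fintype.card S - 1) *
        ‖v - v'‖ := (hilbertTprodL S H).norm_image_sub_le v v'
    _ ≤ 1 * Fintype.card S * M ^ (Fintype.card S - 1) * ε := by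
        gcongr
        · exact norm_hilbertTprodL_le
        · exact max_le ((pi_norm_le_iff_of_nonneg hM).2 hv) ((pi_norm_le_iff_of_nonneg hM).2 hv')
        · exact (pi_norm_le_iff_of_nonneg hε).2 h
    _ = _ := by rw [one_mul]

end ElementaryTensors

section CutNorm

variable {H : Type*} [NormedAddCommGroup H] [InnerProductSpace ℝ H]
  {u u' : unitInterval × unitInterval → H} {δ : ℝ}

theorem cutNorm_nonneg (u : unitInterval × unitInterval → H) : 0 ≤ cutNorm u :=
  Real.sSup_nonneg'
    ⟨0, ⟨0, ∅, ∅, by simp, MeasurableSet.empty, MeasurableSet.empty, by simp⟩, le_rfl⟩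

theorem cutDist_nonneg (u u' : unitInterval × unitInterval → H) : 0 ≤ cutDist u u' :=
  Real.iInf_nonneg fun _ => cutNorm_nonneg _

theorem cutDist_le_cutNorm (u u' : unitInterval × unitInterval → H)
    {φ : unitInterval → unitInterval} (hφ : Function.Bijective φ)
    (hm : MeasurePreserving φ volume volume) :
    cutDist u u' ≤ cutNorm fun z => u z - u' (φ z.1, φ z.2) :=
  ciInf_le ⟨0, Set.forall_mem_range.2 fun _ => cutNorm_nonneg _⟩
    (⟨φ, hφ, hm⟩ : {Φ : unitInterval → unitInterval //
      Function.Bijective Φ ∧ MeasurePreserving Φ volume volume})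

theorem exists_cutNorm_lt_of_cutDist_lt (h : cutDist u u' < δ) :
    ∃ φ : unitInterval → unitInterval, MeasurePreserving φ volume volume ∧
      cutNorm (fun z => u z - u' (φ z.1, φ z.2)) < δ := by
  have : Nonempty {Φ : unitInterval → unitInterval //
      Function.Bijective Φ ∧ MeasurePreserving Φ volume volume} :=
    ⟨⟨id, Function.bijective_id, MeasurePreserving.id _⟩⟩
  obtain ⟨Φ, hΦ⟩ := exists_lt_of_ciInf_lt h
  exact ⟨Φ.1, Φ.2.2, hΦ⟩

theorem cutNorm_le (h : ∀ S T : Set unitInterval, MeasurableSet S → MeasurableSet T →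
    ‖∫ z in S ×ˢ T, u z‖ ≤ δ) : cutNorm u ≤ δ := by
  refine Real.sSup_le ?_ ((norm_nonneg _).trans (h ∅ ∅ MeasurableSet.empty MeasurableSet.empty))
  rintro _ ⟨e, S, T, he, hS, hT, rfl⟩
  calc inner ℝ e (∫ z in S ×ˢ T, u z) ≤ ‖e‖ * ‖∫ z in S ×ˢ T, u z‖ := real_inner_le_norm _ _
    _ ≤ ‖∫ z in S ×ˢ T, u z‖ := mul_le_of_le_one_left (norm_nonneg _) he
    _ ≤ δ := h S T hS hT

theorem inner_setIntegral_le_cutNorm (hu : Integrable u) {e : H} (he : ‖e‖ ≤ 1)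
    {S T : Set unitInterval} (hS : MeasurableSet S) (hT : MeasurableSet T) :
    inner ℝ e (∫ z in S ×ˢ T, u z) ≤ cutNorm u := by
  refine le_csSup ⟨∫ z, ‖u z‖, ?_⟩ ⟨e, S, T, he, hS, hT, rfl⟩
  rintro _ ⟨e, S, T, he, -, -, rfl⟩
  calc inner ℝ e (∫ z in S ×ˢ T, u z) ≤ ‖e‖ * ‖∫ z in S ×ˢ T, u z‖ := real_inner_le_norm _ _
    _ ≤ ‖∫ z in S ×ˢ T, u z‖ := mul_le_of_le_one_left (norm_nonneg _) he
    _ ≤ ∫ z in S ×ˢ T, ‖u z‖ := norm_integral_le_integral_norm _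
    _ ≤ ∫ z, ‖u z‖ := setIntegral_le_integral hu.norm (ae_of_all _ fun _ => norm_nonneg _)

theorem kernelCutLE_inner [CompleteSpace H] (hu : Integrable u) {e : H} (he : ‖e‖ ≤ 1) :
    KernelCutLE (fun z => inner ℝ e (u z)) (cutNorm u) := by
  intro S T hS hT
  rw [integral_inner hu.integrableOn]
  have hneg := inner_setIntegral_le_cutNorm hu ((norm_neg e).trans_le he) hS hT
  rw [inner_neg_left] at hneg
  exact abs_le.2 ⟨neg_le.1 hneg, inner_setIntegral_le_cutNorm hu he hS hT⟩

end CutNorm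

section HomDensity

variable {H : Type*} [NormedAddCommGroup H] [InnerProductSpace ℝ H]
  {u u' : unitInterval × unitInterval → H} {M ε : ℝ}

theorem abs_inner_le_of_norm_le {b x : H} (hb : ‖b‖ = 1) (hx : ‖x‖ ≤ M) : |inner ℝ b x| ≤ M :=
  (abs_real_inner_le_norm _ _).trans (by rwa [hb, one_mul])

theorem IsBoundedKernel.inner (hu : IsBoundedKernel u M) {b : H} (hb : ‖b‖ = 1) :
    IsBoundedKernel (fun z => inner ℝ b (u z)) M :=
  ⟨hu.aestronglyMeasurable.const_inner,
    hu.ae_norm_le.mono fun _ => abs_inner_le_of_norm_le hb⟩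

theorem aestronglyMeasurable_pi {α ι E : Type*} [Finite ι] [MeasurableSpace α] {μ : Measure α}
    [AddCommMonoid E] [TopologicalSpace E] [ContinuousAdd E] {f : α → ι → E}
    (hf : ∀ i, AEStronglyMeasurable (fun x => f x i) μ) : AEStronglyMeasurable f μ := by
  classical
  cases nonempty_fintype ι
  have hsum : f = fun x => ∑ i, Pi.single i (f x i) :=
    funext fun x => (Finset.univ_sum_single (f x)).symm
  rw [hsum]
  exact Finset.aestronglyMeasurable_fun_sum _ fun i _ =>
    (continuous_single i).comp_aestronglyMeasurable (hf i)

variable {V : Type*} [Fintype V] (F : OrientedSimpleGraph V)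

theorem aestronglyMeasurable_hilbertTprod (hu : AEStronglyMeasurable u volume) :
    AEStronglyMeasurable (fun ξ : V → unitInterval =>
      hilbertTprod fun e : F.edges => u (ξ e.1.1, ξ e.1.2)) volume :=
  (hilbertTprodL F.edges H).cont.comp_aestronglyMeasurable <| aestronglyMeasurable_pi fun e =>
    hu.comp_measurePreserving (measurePreserving_edge F e)

theorem integrable_hilbertTprod (hu : IsBoundedKernel u M) :
    Integrable (fun ξ : V → unitInterval =>
      hilbertTprod fun e : F.edges => u (ξ e.1.1, ξ e.1.2)) := by
  refine Integrable.of_bound (aestronglyMeasurable_hilbertTprod F hu.aestronglyMeasurable)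
    (∏ _e : F.edges, M) ?_
  filter_upwards [ae_forall_edge F fun _ => hu.ae_norm_le] with ξ hξ
  rw [norm_hilbertTprod]
  exact Finset.prod_le_prod (fun _ _ => norm_nonneg _) fun e _ => hξ e

theorem norm_homDensity_sub_le (hu : IsBoundedKernel u M) (hu' : IsBoundedKernel u' M)
    (h : ∀ᵐ z, ‖u z - u' z‖ ≤ ε) :
    ‖homDensity F u - homDensity F u'‖ ≤ F.edges.card * M ^ (F.edges.card - 1) * ε := by
  have hε : 0 ≤ ε := let ⟨_, hz⟩ := h.exists; (norm_nonneg _).trans hz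
  rw [homDensity, homDensity,
    ← integral_sub (integrable_hilbertTprod F hu) (integrable_hilbertTprod F hu')]
  refine (norm_integral_le_of_norm_le_const
    (C := F.edges.card * M ^ (F.edges.card - 1) * ε) ?_).trans (by simp)
  filter_upwards [ae_forall_edge F fun _ => hu.ae_norm_le,
    ae_forall_edge F fun _ => hu'.ae_norm_le, ae_forall_edge F fun _ => h] with ξ hξ hξ' hsub
  simpa only [Fintype.card_coe] using norm_hilbertTprod_sub_le hu.nonneg hε hξ hξ' hsub

theorem homDensity_comp (hu : AEStronglyMeasurable u volume) {φ : unitInterval → unitInterval}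
    (hφ : MeasurePreserving φ volume volume) :
    homDensity F (fun z => u (φ z.1, φ z.2)) = homDensity F u := by
  have hpi : MeasurePreserving (fun (ξ : V → unitInterval) i => φ (ξ i)) volume volume :=
    measurePreserving_pi (fun _ : V => (volume : Measure unitInterval)) (fun _ => volume)
      fun _ => hφ
  have hmap := integral_map (f := fun ξ : V → unitInterval =>
    hilbertTprod fun e : F.edges => u (ξ e.1.1, ξ e.1.2)) hpi.measurable.aemeasurable
    (by rw [hpi.map_eq]; exact aestronglyMeasurable_hilbertTprod F hu)
  rw [hpi.map_eq] at hmap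
  exact hmap.symm

theorem inner_hilbertTprod_homDensity (hu : IsBoundedKernel u M) (b : F.edges → H) :
    inner ℝ (hilbertTprod b) (homDensity F u) =
      kernelMoment F (fun e z => inner ℝ (b e) (u z)) := by
  rw [homDensity, ← integral_inner (integrable_hilbertTprod F hu)]
  simp only [inner_hilbertTprod, kernelMoment]

theorem homDensity_sum_smul [DecidableEq V] {C : Type*} [Fintype C] (b : C → H)
    {U : C → unitInterval × unitInterval → ℝ} (hM : 1 ≤ M) (hU : ∀ c, IsBoundedKernel (U c) M) :
    homDensity F (fun z => ∑ c, U c z • b c) = ∑ k : F.edges → C,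
      kernelMoment F (fun e => U (k e)) • hilbertTprod fun e => b (k e) := by
  have hexpand (ξ : V → unitInterval) :
      (hilbertTprod fun e : F.edges => ∑ c, U c (ξ e.1.1, ξ e.1.2) • b c) =
        ∑ k : F.edges → C, (∏ e, U (k e) (ξ e.1.1, ξ e.1.2)) • hilbertTprod fun e => b (k e) := by
    simp only [← hilbertTprodL_apply, ContinuousMultilinearMap.map_sum,
      ContinuousMultilinearMap.map_smul_univ]
  simp only [homDensity, hexpand]
  rw [integral_finsetSum _ fun k _ =>
    (integrable_prod_edge hM fun e => hU (k e)).smul_const _]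
  simp only [integral_smul_const, kernelMoment]

end HomDensity

section FiniteDimensionalProjection

variable {H : Type*} [NormedAddCommGroup H] [InnerProductSpace ℝ H]

theorem exists_finiteDimensional_norm_sub_starProjection_le {K : Set H} (hK : IsCompact K) {ε : ℝ}
    (hε : 0 < ε) : ∃ (W : Submodule ℝ H) (_ : FiniteDimensional ℝ W),
      ∀ x ∈ K, ‖x - W.starProjection x‖ ≤ ε := by
  obtain ⟨t, -, ht, hcover⟩ := hK.finite_cover_balls hε
  have : FiniteDimensional ℝ (Submodule.span ℝ t) := FiniteDimensional.span_of_finite ℝ ht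
  refine ⟨Submodule.span ℝ t, this, fun x hx => ?_⟩
  obtain ⟨y, hy, hxy⟩ := Set.mem_iUnion₂.1 (hcover hx)
  calc ‖x - (Submodule.span ℝ t).starProjection x‖
      = ⨅ y : Submodule.span ℝ t, ‖x - y‖ := Submodule.starProjection_minimal x
    _ ≤ ‖x - y‖ := ciInf_le ⟨0, Set.forall_mem_range.2 fun _ => norm_nonneg _⟩
        (⟨y, Submodule.subset_span hy⟩ : Submodule.span ℝ t)
    _ ≤ ε := (mem_ball_iff_norm.1 hxy).le

variable {W : Submodule ℝ H} [W.HasOrthogonalProjection] {C : Type*} [Fintype C]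
  (b : OrthonormalBasis C ℝ W) {u u' : unitInterval × unitInterval → H} {M ε ρ : ℝ}

theorem starProjection_eq_sum_inner_smul (x : H) :
    W.starProjection x = ∑ c, inner ℝ (b c : H) x • (b c : H) := by
  simp [b.starProjection_eq_sum_rankOne]

variable (W) in
theorem IsBoundedKernel.starProjection (hu : IsBoundedKernel u M) :
    IsBoundedKernel (fun z => W.starProjection (u z)) M :=
  ⟨W.starProjection.continuous.comp_aestronglyMeasurable hu.aestronglyMeasurable,
    hu.ae_norm_le.mono fun _ hz => (W.norm_starProjection_apply_le _).trans hz⟩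

theorem norm_homDensity_starProjection_sub_le {V : Type*} [Fintype V] (F : OrientedSimpleGraph V)
    (hM : 1 ≤ M) (hε : 0 ≤ ε) (hu : IsBoundedKernel u M) (hu' : IsBoundedKernel u' M)
    (hcut : ∀ c, KernelCutLE (fun z => inner ℝ (b c : H) (u z) - inner ℝ (b c : H) (u' z)) ε) :
    ‖homDensity F (fun z => W.starProjection (u z)) -
        homDensity F (fun z => W.starProjection (u' z))‖ ≤
      Fintype.card C ^ F.edges.card *
        (F.edges.card * (4 * M ^ F.edges.card * M ^ F.edges.card * ε)) := by
  classical
  have hb (c : C) : ‖(b c : H)‖ = 1 := b.orthonormal.1 c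
  simp only [starProjection_eq_sum_inner_smul b]
  rw [homDensity_sum_smul F _ hM fun c => hu.inner (hb c),
    homDensity_sum_smul F _ hM fun c => hu'.inner (hb c), ← Finset.sum_sub_distrib]
  have hk (k : F.edges → C) :
      ‖kernelMoment F (fun e z => inner ℝ (b (k e) : H) (u z)) •
            hilbertTprod (fun e => (b (k e) : H)) -
          kernelMoment F (fun e z => inner ℝ (b (k e) : H) (u' z)) •
            hilbertTprod (fun e => (b (k e) : H))‖ ≤
        F.edges.card * (4 * M ^ F.edges.card * M ^ F.edges.card * ε) := by
    rw [← sub_smul, norm_smul, norm_hilbertTprod]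
    simp only [hb, Finset.prod_const_one, mul_one, Real.norm_eq_abs]
    exact abs_kernelMoment_sub_le_of_kernelCutLE hM hε (fun e => hu.inner (hb _))
      (fun e => hu'.inner (hb _)) fun e => hcut _
  refine (norm_sum_le_of_le _ fun k _ => hk k).trans_eq ?_
  simp

variable [CompleteSpace H]

theorem norm_setIntegral_le_of_starProjection (hu : Integrable u) (hρ : 0 ≤ ρ)
    (hW : ∀ᵐ z, ‖u z - W.starProjection (u z)‖ ≤ ρ)
    (hcut : ∀ c, KernelCutLE (fun z => inner ℝ (b c : H) (u z)) ε)
    {S T : Set unitInterval} (hS : MeasurableSet S) (hT : MeasurableSet T) :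
    ‖∫ z in S ×ˢ T, u z‖ ≤ ρ + Fintype.card C * ε := by
  have hP : Integrable fun z => W.starProjection (u z) := W.starProjection.integrable_comp hu
  have herr : ‖∫ z in S ×ˢ T, (u z - W.starProjection (u z))‖ ≤ ρ := by
    refine (norm_integral_le_of_norm_le_const (ae_restrict_of_ae hW)).trans ?_
    rw [measureReal_restrict_apply_univ]
    exact mul_le_of_le_one_right hρ measureReal_le_one
  have hcoord (c : C) : ‖inner ℝ (b c : H) (∫ z in S ×ˢ T, u z) • (b c : H)‖ ≤ ε := by
    rw [norm_smul, ← integral_inner hu.integrableOn]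
    exact (mul_le_of_le_one_right (norm_nonneg _) (b.orthonormal.1 c).le).trans (hcut c hS hT)
  have hproj : ‖∫ z in S ×ˢ T, W.starProjection (u z)‖ ≤ Fintype.card C * ε := by
    rw [W.starProjection.integral_comp_comm hu.integrableOn, starProjection_eq_sum_inner_smul b]
    exact (norm_sum_le_of_le _ fun c _ => hcoord c).trans_eq (by simp)
  calc ‖∫ z in S ×ˢ T, u z‖
      = ‖(∫ z in S ×ˢ T, (u z - W.starProjection (u z))) +
          ∫ z in S ×ˢ T, W.starProjection (u z)‖ := by
        rw [integral_sub hu.integrableOn hP.integrableOn, sub_add_cancel]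
    _ ≤ ρ + Fintype.card C * ε := (norm_add_le _ _).trans (add_le_add herr hproj)

end FiniteDimensionalProjection

section CompactValues

theorem exists_isBoundedKernel_of_isCompact {E : Type*} [NormedAddCommGroup E] {K : Set E}
    (hK : IsCompact K) : ∃ M : ℝ, 1 ≤ M ∧
      ∀ {u : unitInterval × unitInterval → E}, AEStronglyMeasurable u volume → (∀ᵐ z, u z ∈ K) →
        IsBoundedKernel u M := by
  obtain ⟨M, hM⟩ := hK.isBounded.exists_norm_le
  exact ⟨max M 1, le_max_right _ _, fun hu hKu =>
    ⟨hu, hKu.mono fun z hz => (hM _ hz).trans (le_max_left _ _)⟩⟩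

variable {H : Type*} [NormedAddCommGroup H] [InnerProductSpace ℝ H] [CompleteSpace H] {K : Set H}
  {ε : ℝ}

theorem exists_norm_homDensity_sub_le {V : Type*} [Fintype V] (F : OrientedSimpleGraph V)
    (hK : IsCompact K) (hε : 0 < ε) :
    ∃ δ : ℝ, 0 < δ ∧ ∀ {u u' : unitInterval × unitInterval → H}, AEStronglyMeasurable u volume →
      AEStronglyMeasurable u' volume → (∀ᵐ z, u z ∈ K) → (∀ᵐ z, u' z ∈ K) →
      cutNorm (fun z => u z - u' z) ≤ δ → ‖homDensity F u - homDensity F u'‖ ≤ ε := by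
  obtain ⟨M, hM, hbounded⟩ := exists_isBoundedKernel_of_isCompact hK
  obtain ⟨ρ, hρ, hρε⟩ :=
    exists_pos_mul_lt (show 0 < ε / 4 by positivity) (F.edges.card * M ^ (F.edges.card - 1))
  obtain ⟨W, _, hW⟩ := exists_finiteDimensional_norm_sub_starProjection_le hK hρ
  let b := stdOrthonormalBasis ℝ W
  have hb (c) : ‖(b c : H)‖ = 1 := b.orthonormal.1 c
  obtain ⟨δ, hδ, hδε⟩ := exists_pos_mul_lt (half_pos hε)
    (Module.finrank ℝ W ^ F.edges.card * (F.edges.card * (4 * M ^ F.edges.card * M ^ F.edges.card)))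
  refine ⟨δ, hδ, fun {u u'} hu hu' hKu hKu' hcut => ?_⟩
  have hbu := hbounded hu hKu
  have hbu' := hbounded hu' hKu'
  have hproj := (norm_homDensity_sub_le F hbu (hbu.starProjection W)
    (hKu.mono fun z hz => hW _ hz)).trans hρε.le
  have hproj' := (norm_homDensity_sub_le F hbu' (hbu'.starProjection W)
    (hKu'.mono fun z hz => hW _ hz)).trans hρε.le
  have hsub : Integrable fun z => u z - u' z := hbu.integrable.sub hbu'.integrable
  have hcoord := norm_homDensity_starProjection_sub_le b F hM hδ.le hbu hbu' fun c S T hS hT => by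
    simpa only [inner_sub_right] using
      (kernelCutLE_inner hsub (hb c).le hS hT).trans hcut
  rw [Fintype.card_fin] at hcoord
  rw [norm_sub_rev] at hproj'
  have h1 := norm_sub_le_norm_sub_add_norm_sub (homDensity F u)
    (homDensity F fun z => W.starProjection (u z)) (homDensity F u')
  have h2 := norm_sub_le_norm_sub_add_norm_sub (homDensity F fun z => W.starProjection (u z))
    (homDensity F fun z => W.starProjection (u' z)) (homDensity F u')
  linarith

theorem exists_cutDist_le (hK : IsCompact K) (hε : 0 < ε) :
    ∃ (k : ℕ) (η : ℝ), 0 < η ∧ ∀ {u u' : unitInterval × unitInterval → H},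
      AEStronglyMeasurable u volume → AEStronglyMeasurable u' volume →
      (∀ᵐ z, u z ∈ K) → (∀ᵐ z, u' z ∈ K) →
      (∀ F : OrientedSimpleGraph (Fin k), ‖homDensity F u - homDensity F u'‖ ≤ η) →
      cutDist u u' ≤ ε := by
  obtain ⟨M, hM, hbounded⟩ := exists_isBoundedKernel_of_isCompact hK
  obtain ⟨W, _, hW⟩ :=
    exists_finiteDimensional_norm_sub_starProjection_le hK (show 0 < ε / 4 by positivity)
  let b := stdOrthonormalBasis ℝ W
  have hb (c) : ‖(b c : H)‖ = 1 := b.orthonormal.1 c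
  obtain ⟨δ, hδ, hδε⟩ := exists_pos_mul_lt (half_pos hε) (Module.finrank ℝ W : ℝ)
  obtain ⟨k, η, hη, hscalar⟩ :=
    exists_measurePreserving_kernelCutLE (Fin (Module.finrank ℝ W)) hM hδ
  refine ⟨k, η, hη, fun {u u'} hu hu' hKu hKu' hmom => ?_⟩
  have hbu := hbounded hu hKu
  have hbu' := hbounded hu' hKu'
  obtain ⟨φ, hφ, hcut⟩ := hscalar (fun c => hbu.inner (hb c)) (fun c => hbu'.inner (hb c))
    fun F c => by
      rw [← inner_hilbertTprod_homDensity F hbu fun e => (b (c e) : H),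
        ← inner_hilbertTprod_homDensity F hbu' fun e => (b (c e) : H), ← inner_sub_right]
      exact abs_inner_le_of_norm_le (by simp [norm_hilbertTprod, hb]) (hmom F)
  have hφφ := hφ.prod hφ
  refine (cutDist_le_cutNorm u u' φ.bijective hφ).trans <| cutNorm_le fun S T hS hT => ?_
  have hW' : ∀ᵐ z, ‖u z - u' (φ z.1, φ z.2) -
      W.starProjection (u z - u' (φ z.1, φ z.2))‖ ≤ ε / 4 + ε / 4 := by
    filter_upwards [hKu, hφφ.quasiMeasurePreserving.ae hKu'] with z hz hz'
    rw [map_sub, sub_sub_sub_comm]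
    exact (norm_sub_le _ _).trans (add_le_add (hW _ hz) (hW _ hz'))
  have hsub : Integrable fun z => u z - u' (φ z.1, φ z.2) :=
    hbu.integrable.sub (hφφ.integrable_comp_of_integrable hbu'.integrable)
  have hint := norm_setIntegral_le_of_starProjection b hsub (by positivity) hW'
    (by simpa only [inner_sub_right] using hcut) hS hT
  rw [Fintype.card_fin] at hint
  linarith

end CompactValues

section Convergence

variable {H : Type*} [NormedAddCommGroup H] [InnerProductSpace ℝ H] [CompleteSpace H] {K : Set H}
  {u : ℕ → unitInterval × unitInterval → H} {u' : unitInterval × unitInterval → H}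

instance OrientedSimpleGraph.instFinite (V : Type*) [Finite V] : Finite (OrientedSimpleGraph V) :=
  Finite.of_injective OrientedSimpleGraph.edges fun F G h => by
    cases F; cases G; cases h; rfl

theorem tendsto_cutDist_of_tendsto_homDensity (hK : IsCompact K)
    (hu : ∀ n, AEStronglyMeasurable (u n) volume) (hu' : AEStronglyMeasurable u' volume)
    (hKu : ∀ n, ∀ᵐ z, u n z ∈ K) (hKu' : ∀ᵐ z, u' z ∈ K)
    (h : ∀ (k : ℕ) (F : OrientedSimpleGraph (Fin k)),
      Tendsto (fun n => ‖homDensity F (u n) - homDensity F u'‖) atTop (𝓝 0)) :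
    Tendsto (fun n => cutDist (u n) u') atTop (𝓝 0) := by
  refine tendsto_order.2 ⟨fun ε hε => .of_forall fun n => hε.trans_le (cutDist_nonneg _ _),
    fun ε hε => ?_⟩
  obtain ⟨k, η, hη, hcut⟩ := exists_cutDist_le hK (half_pos hε)
  filter_upwards [eventually_all.2 fun F => (h k F).eventually_le_const hη] with n hn
  exact (hcut (hu n) hu' (hKu n) hKu' hn).trans_lt (half_lt_self hε)

theorem tendsto_homDensity_of_tendsto_cutDist {V : Type*} [Fintype V] (F : OrientedSimpleGraph V)
    (hK : IsCompact K) (hu : ∀ n, AEStronglyMeasurable (u n) volume)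
    (hu' : AEStronglyMeasurable u' volume) (hKu : ∀ n, ∀ᵐ z, u n z ∈ K) (hKu' : ∀ᵐ z, u' z ∈ K)
    (h : Tendsto (fun n => cutDist (u n) u') atTop (𝓝 0)) :
    Tendsto (fun n => ‖homDensity F (u n) - homDensity F u'‖) atTop (𝓝 0) := by
  refine tendsto_order.2 ⟨fun ε hε => .of_forall fun n => hε.trans_le (norm_nonneg _),
    fun ε hε => ?_⟩
  obtain ⟨δ, hδ, hcount⟩ := exists_norm_homDensity_sub_le F hK (half_pos hε)
  filter_upwards [h.eventually_lt_const hδ] with n hn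
  obtain ⟨φ, hφ, hcut⟩ := exists_cutNorm_lt_of_cutDist_lt hn
  have hφφ := hφ.prod hφ
  rw [← homDensity_comp F hu' hφ]
  exact (hcount (hu n) (hu'.comp_measurePreserving hφφ) (hKu n)
    (hφφ.quasiMeasurePreserving.ae hKu') hcut.le).trans_lt (half_lt_self hε)

theorem lemma2p15_general (hK : IsCompact K) (hu : ∀ n, AEStronglyMeasurable (u n) volume)
    (hu' : AEStronglyMeasurable u' volume) (hKu : ∀ n, ∀ᵐ z, u n z ∈ K) (hKu' : ∀ᵐ z, u' z ∈ K) :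
    (∀ (V : Type) [Fintype V] (F : OrientedSimpleGraph V),
        Tendsto (fun n => ‖homDensity F (u n) - homDensity F u'‖) atTop (𝓝 0)) ↔
      Tendsto (fun n => cutDist (u n) u') atTop (𝓝 0) :=
  ⟨fun h => tendsto_cutDist_of_tendsto_homDensity hK hu hu' hKu hKu' fun k => h (Fin k),
    fun h _ _ F => tendsto_homDensity_of_tendsto_cutDist F hK hu hu' hKu hKu' h⟩

end Convergence

section CompactEmbedding

variable {B H : Type*} [NormedAddCommGroup B] [NormedSpace ℝ B] [NormedAddCommGroup H]
  [InnerProductSpace ℝ H] {ι : B →L[ℝ] H}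

theorem ae_mem_closure_image_closedBall {w : unitInterval × unitInterval → B} {R : ℝ≥0}
    (h : eLpNorm w ∞ volume ≤ R) : ∀ᵐ z, ι (w z) ∈ closure (ι '' Metric.closedBall 0 R) := by
  rw [eLpNorm_exponent_top] at h
  filter_upwards [ae_le_eLpNormEssSup (f := w) (μ := volume)] with z hz
  exact subset_closure ⟨w z, mem_closedBall_zero_iff.2 (enorm_le_coe.1 (hz.trans h)), rfl⟩

theorem exists_isCompact_ae_mem (hι : IsCompactOperator ι)
    {w : ℕ → unitInterval × unitInterval → B} {w' : unitInterval × unitInterval → B}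
    (hw : ⨆ n, eLpNorm (w n) ∞ volume < ∞) (hw' : eLpNorm w' ∞ volume < ∞) :
    ∃ K : Set H, IsCompact K ∧ (∀ n, ∀ᵐ z, ι (w n z) ∈ K) ∧ ∀ᵐ z, ι (w' z) ∈ K := by
  obtain ⟨R, hR⟩ := ENNReal.lt_iff_exists_coe.1 (max_lt hw hw')
  have hwR : ∀ n, eLpNorm (w n) ∞ volume ≤ R := fun n =>
    (le_iSup (fun n => eLpNorm (w n) ∞ volume) n).trans ((le_max_left _ _).trans hR.1.le)
  exact ⟨_, hι.isCompact_closure_image_closedBall R,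
    fun n => ae_mem_closure_image_closedBall (hwR n),
    ae_mem_closure_image_closedBall ((le_max_right _ _).trans hR.1.le)⟩

end CompactEmbedding

end

theorem lemma2p15 {B H : Type*}
    [NormedAddCommGroup B] [NormedSpace ℝ B] [CompleteSpace B]
    [NormedAddCommGroup H] [InnerProductSpace ℝ H] [CompleteSpace H]
    [TopologicalSpace.SeparableSpace H]
    (ι : B →L[ℝ] H) (hι : Function.Injective ι) (hcpt : IsCompactOperator ι)
    (w : ℕ → unitInterval × unitInterval → B) (w' : unitInterval × unitInterval → B)
    (hw : ∀ n, IsLinftyKernel ι (w n)) (hw' : IsLinftyKernel ι w')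
    (wmax : ℝ≥0) (hbound : ⨆ n, eLpNorm (w n) ∞ volume < wmax) :
    (∀ (V : Type) [Fintype V] (F : OrientedSimpleGraph V),
        Tendsto (fun n => ‖homDensity F (fun z => ι (w n z)) - homDensity F (fun z => ι (w' z))‖)
          atTop (𝓝 0)) ↔
      Tendsto (fun n => cutDist (fun z => ι (w n z)) (fun z => ι (w' z))) atTop (𝓝 0) := by
  obtain ⟨K, hK, hKw, hKw'⟩ :=
    exists_isCompact_ae_mem hcpt (hbound.trans ENNReal.coe_lt_top) hw'.2
  exact lemma2p15_general hK (fun n => (hw n).1) hw'.1 hKw hKw'
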